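/- Let $g,p\in\mathbb N$ be fixed, let $\tau\in(0,1)$, $\gamma>0$, and consider the linear model with $g$ groups of $p$ explanatory variables $$Y_i=\mathbb X_i^t\beta^0+\varepsilon_i,\qquad i=1,2,\dots,$$ with deterministic $\mathbb X_i\in\mathbb R^{gp}$ and a parameter $\beta^0=(\beta^0_1,\dots,\beta^0_g)$, $\beta^0_j\in\mathbb R^p$, not depending on $n$. Let $\mathcal A^0=\{j:\beta^0_j\neq 0\}$. Let $\rho_\tau(u)=u(\tau-1_{u<0})$ and $G_n(\beta)=\sum_{i=1}^n\rho_\tau(Y_i-\mathbb X_i^t\beta)$, let $\widetilde\beta=\widetilde\beta^{(n)}$ be a measurable minimizer of $G_n$ over $\mathbb R^{gp}$, and let $\widehat\beta=\widehat\beta^{(n)}$ be a measurable minimizer over $\mathbb R^{gp}$ of $$E_n(\beta)=G_n(\beta)+\lambda_{1n}\sum_{j=1}^g\|\widetilde\beta_j\|_2^{-\gamma}\|\beta_j\|_2+\lambda_{2n}\sum_{j=1}^g\|\beta_j\|_2^2,\qquad \lambda_{1n},\lambda_{2n}\ge 0,$$ where $0^{-\gamma}=\infty$ and $\infty\cdot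 0=0$. Suppose that: (A1) $(\varepsilon_i)$ are i.i.d. with a density $f$ and $\mathbb P[\varepsilon_i<0]=\tau$; in a neighbourhood of $0$, $f$ is continuous, strictly positive and differentiable with bounded derivative. (A6) $n^{-1}\max_{1\le i\le n}\mathbb X_i^t\mathbb X_i\to 0$ and $n^{-1}\sum_{i=1}^n\mathbb X_i\mathbb X_i^t\to\Upsilon$ with $\Upsilon$ a positive definite $gp\times gp$ matrix. (C1) As $n\to\infty$: $\lambda_{1n}\to\infty$, $\lambda_{2n}\to\infty$, $n^{-1/2}\lambda_{1n}\to0$, $n^{(\gamma-1)/2}\lambda_{1n}\to\infty$, $n^{-1/2}\lambda_{2n}\to0$. Then $$n^{1/2}(\widehat\beta-\beta^0)_{\mathcal A^0}\ \xrightarrow{\ \mathcal L\ }\ \mathcal N\big(0,\ \tau(1-\tau)f(0)^{-2}\,\Upsilon_{\mathcal A^0}^{-1}\big),$$ where $v_{\mathcal A^0}$ is the subvector of $v$ formed by the groups $j\in\mathcal A^0$ and $\Upsilon_{\mathcal A^0}$ is the submatrix of $\Upsilon$ with rows and columns in the groups of $\mathcal A^0$. -/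

import Mathlib

open MeasureTheory ProbabilityTheory Filter Topology
open scoped ENNReal NNReal

namespace GroupQuantile

/-- Parameters and explanatory variables: `g` groups of `p` real coordinates each, with the
Euclidean norm; the coordinate `(j, k)` is the `k`-th coordinate of the group `j`. -/
abbrev Param (g p : ℕ) : Type := EuclideanSpace ℝ (Fin g × Fin p)

/-- The subvector `b_j ∈ ℝ^p` of the group `j`. -/
def block {g p : ℕ} (b : Param g p) (j : Fin g) : EuclideanSpace ℝ (Fin p) :=
  WithLp.toLp 2 (fun k => b (j, k))

/-- The set of significant groups: the indices `j` with `b_j ≠ 0`. -/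
noncomputable def activeGroups {g p : ℕ} (b : Param g p) : Finset (Fin g) :=
  open Classical in Finset.univ.filter (fun j => block b j ≠ 0)

/-- Coordinates that belong to the groups of index in `A`. -/
abbrev SubIndex {g : ℕ} (p : ℕ) (A : Finset (Fin g)) : Type := {q : Fin g × Fin p // q.1 ∈ A}

/-- The subvector `b_A` of `b` formed by the groups of index in `A`. -/
def subvector {g p : ℕ} (A : Finset (Fin g)) (b : Param g p) :
    EuclideanSpace ℝ (SubIndex p A) :=
  WithLp.toLp 2 (fun q => b q.1)

/-- The submatrix `M_A` of rows and columns in the groups of index in `A`. -/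
def submatrixOn {g p : ℕ} (A : Finset (Fin g)) (M : Matrix (Fin g × Fin p) (Fin g × Fin p) ℝ) :
    Matrix (SubIndex p A) (SubIndex p A) ℝ :=
  M.submatrix Subtype.val Subtype.val

/-- The quantile (check) loss `ρ_τ(u) = u (τ - 1_{u < 0})`. -/
noncomputable def checkLoss (τ u : ℝ) : ℝ := u * (τ - if u < 0 then 1 else 0)

/-- The quantile process `G_n(b) = ∑ ρ_τ(y_i - x_iᵗ b)` over the first `n` observations. -/
noncomputable def quantileProcess {g p : ℕ} (τ : ℝ) (x : ℕ → Param g p) (y : ℕ → ℝ) (n : ℕ)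
    (b : Param g p) : ℝ :=
  ∑ i ∈ Finset.range n, checkLoss τ (y i - inner ℝ (x i) b)

/-- `b` is a group quantile estimate: a minimizer of `G_n` over the whole space. -/
def IsQuantileEstimate {g p : ℕ} (τ : ℝ) (x : ℕ → Param g p) (y : ℕ → ℝ) (n : ℕ)
    (b : Param g p) : Prop :=
  ∀ b' : Param g p, quantileProcess τ x y n b ≤ quantileProcess τ x y n b'

/-- The adaptive weight `‖b_j‖₂ ^ (-γ)`, which is `∞` if `b_j = 0` (and `γ > 0`). -/
noncomputable def adaptiveWeight {g p : ℕ} (γ : ℝ) (b : Param g p) (j : Fin g) : ℝ≥0∞ :=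
  ENNReal.ofReal ‖block b j‖ ^ (-γ)

/-- The adaptive elastic-net group quantile process
`E_n(b) = G_n(b) + l₁ ∑ w_j ‖b_j‖₂ + l₂ ∑ ‖b_j‖₂²` with the weights `w_j` computed from `bt`.
All summands are nonnegative if `0 < τ < 1`; a group of infinite weight contributes `∞`
unless it vanishes (`∞ * 0 = 0`). -/
noncomputable def elasticNetProcess {g p : ℕ} (τ γ : ℝ) (l₁ l₂ : ℝ≥0) (x : ℕ → Param g p)
    (y : ℕ → ℝ) (n : ℕ) (bt b : Param g p) : ℝ≥0∞ :=
  ENNReal.ofReal (quantileProcess τ x y n b)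
    + (l₁ : ℝ≥0∞) * ∑ j, adaptiveWeight γ bt j * ENNReal.ofReal ‖block b j‖
    + (l₂ : ℝ≥0∞) * ∑ j, ENNReal.ofReal (‖block b j‖ ^ 2)

/-- `b` is an adaptive elastic-net group quantile estimate: a minimizer of `E_n` over the whole
space, with the weights computed from the quantile estimate `bt`. -/
def IsElasticNetEstimate {g p : ℕ} (τ γ : ℝ) (l₁ l₂ : ℝ≥0) (x : ℕ → Param g p)
    (y : ℕ → ℝ) (n : ℕ) (bt b : Param g p) : Prop :=
  ∀ b' : Param g p,
    elasticNetProcess τ γ l₁ l₂ x y n bt b ≤ elasticNetProcess τ γ l₁ l₂ x y n bt b'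

/-- The errors are i.i.d. with density `f` and `P[ε < 0] = τ`; near `0` the density is
continuous, strictly positive and differentiable with a bounded derivative. -/
structure ErrorAssumption {Ω : Type*} [MeasurableSpace Ω] (P : Measure Ω) (ε : ℕ → Ω → ℝ)
    (f : ℝ → ℝ) (τ : ℝ) : Prop where
  measurable : ∀ i, Measurable (ε i)
  indep : iIndepFun ε P
  density_measurable : Measurable f
  density_nonneg : ∀ x, 0 ≤ f x
  law : ∀ i, P.map (ε i) = volume.withDensity (fun x => ENNReal.ofReal (f x))
  quantile : ∀ i, P.real {ω | ε i ω < 0} = τ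
  density_near_zero : ∃ M : ℝ, ∀ᶠ u in 𝓝 (0 : ℝ),
    ContinuousAt f u ∧ 0 < f u ∧ DifferentiableAt ℝ f u ∧ |deriv f u| ≤ M

/-- `n⁻¹ max_{i ≤ n} x_iᵗ x_i → 0` and `n⁻¹ ∑_{i ≤ n} x_i x_iᵗ → U` with `U` positive definite. -/
structure DesignAssumption {g p : ℕ} (x : ℕ → Param g p)
    (U : Matrix (Fin g × Fin p) (Fin g × Fin p) ℝ) : Prop where
  max_tendsto : Tendsto (fun n : ℕ => (n : ℝ)⁻¹ * ⨆ i : Fin n, inner ℝ (x i) (x i)) atTop (𝓝 0)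
  gram_tendsto : Tendsto
    (fun n : ℕ => (n : ℝ)⁻¹ • ∑ i ∈ Finset.range n, Matrix.vecMulVec (x i).ofLp (x i).ofLp)
    atTop (𝓝 U)
  posDef : U.PosDef

/-- The conditions on the tuning parameters `l₁ n`, `l₂ n` and on the power `γ`. -/
structure TuningCondition (γ : ℝ) (l₁ l₂ : ℕ → ℝ≥0) : Prop where
  l₁_atTop : Tendsto l₁ atTop atTop
  l₂_atTop : Tendsto l₂ atTop atTop
  l₁_small : Tendsto (fun n : ℕ => (n : ℝ) ^ (-(1 / 2) : ℝ) * (l₁ n : ℝ)) atTop (𝓝 0)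
  l₁_large : Tendsto (fun n : ℕ => (n : ℝ) ^ ((γ - 1) / 2) * (l₁ n : ℝ)) atTop atTop
  l₂_small : Tendsto (fun n : ℕ => (n : ℝ) ^ (-(1 / 2) : ℝ) * (l₂ n : ℝ)) atTop (𝓝 0)

end GroupQuantile

namespace GroupQuantile

/-! ### The check loss and its remainder of first order -/

/-! Rescale by u = √n (b - β₀). Knight's identity splits G_n(β₀ + u/√n) - G_n(β₀) into -W_nᵗu +
R_n(u), where W_n is the normalized score sum (`scoreSum`) and R_n is a sum of nonnegative
remainders. Each remainder sees only errors close to 0. Hence R_n(u) has mean close to f(0) uᵗUu/2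
and vanishing variance, and a Lipschitz bound makes the convergence uniform on balls
(`eventuallyLikely_remainderSum`). Chebyshev's inequality makes W_n tight (`scoreSum_tight`).

Since G_n is convex, the quadratic expansion on one large ball keeps the rescaled quantile estimate
inside it (`norm_le_of_convex_ray`). So the weights of the significant groups stay bounded, while
those of the other groups are at least of order n^{γ/2}. In rescaled coordinates the penalty then
costs O((λ₁ + λ₂)/√n) → 0 on the significant groups, and at least a constant times n^{(γ-1)/2} λ₁
per unit of norm on the others. This confines the rescaled elastic-net error to the same ball and
sends its insignificant blocks to zero (`rescaled_bounds`). Exact sparsity is not needed.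

The error therefore nearly minimizes f(0)/2 uᵗUu - W_nᵗu among vectors supported on the significant
groups. Positive definiteness of U turns near minimality into closeness to the exact minimizer,
which is linear in W_n (`limitForm_sub_oracle_le`, `exists_likely_close_oracle`). A central limit
theorem by characteristic functions gives the law of this oracle (`tendstoInDistribution_oracle`),
and Slutsky's lemma transfers it to the estimate. -/

/-- The subgradient `τ - 1_{e < 0}` of the check loss. -/
noncomputable def checkScore (τ e : ℝ) : ℝ := τ - if e < 0 then 1 else 0

/-- The remainder `ρ_τ(e - v) - ρ_τ(e) + v (τ - 1_{e < 0})` in Knight's identity, which does not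
depend on `τ`. -/
noncomputable def knightRemainder (v e : ℝ) : ℝ :=
  if 0 ≤ e then max (v - e) 0 else max (e - v) 0

lemma checkLoss_sub (τ v e : ℝ) :
    checkLoss τ (e - v) = checkLoss τ e - v * checkScore τ e + knightRemainder v e := by
  unfold checkLoss checkScore knightRemainder
  rcases lt_or_ge e 0 with he | he <;> rcases lt_or_ge (e - v) 0 with hv | hv
  · rw [if_pos hv, if_pos he, if_neg (not_le.2 he), max_eq_right hv.le]; ring
  · rw [if_neg (not_lt.2 hv), if_pos he, if_neg (not_le.2 he), max_eq_left hv]; ring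
  · rw [if_pos hv, if_neg (not_lt.2 he), if_pos he, max_eq_left (by linarith)]; ring
  · rw [if_neg (not_lt.2 hv), if_neg (not_lt.2 he), if_pos he, max_eq_right (by linarith)]; ring

lemma checkLoss_eq_max {τ : ℝ} (u : ℝ) : checkLoss τ u = max (τ * u) ((τ - 1) * u) := by
  unfold checkLoss
  rcases lt_or_ge u 0 with hu | hu
  · rw [if_pos hu, max_eq_right (by nlinarith)]; ring
  · rw [if_neg (not_lt.2 hu), max_eq_left (by nlinarith)]; ring

lemma checkLoss_nonneg {τ : ℝ} (hτ : τ ∈ Set.Ioo (0 : ℝ) 1) (u : ℝ) : 0 ≤ checkLoss τ u := by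
  rw [checkLoss_eq_max]
  rcases le_total 0 u with hu | hu
  · exact le_max_of_le_left (mul_nonneg hτ.1.le hu)
  · exact le_max_of_le_right (mul_nonneg_of_nonpos_of_nonpos (by linarith [hτ.2]) hu)

/-- Convexity: the loss is a maximum of two linear functions. This is what later lets control on a
sphere exclude minimizers outside it. -/
lemma checkLoss_sub_mul_le (τ e v : ℝ) {s : ℝ} (hs : s ∈ Set.Icc (0 : ℝ) 1) :
    checkLoss τ (e - s * v) ≤ (1 - s) * checkLoss τ e + s * checkLoss τ (e - v) := by
  have h1 : 0 ≤ 1 - s := by linarith [hs.2]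
  simp only [checkLoss_eq_max]
  apply max_le
  · have := mul_le_mul_of_nonneg_left (le_max_left (τ * e) ((τ - 1) * e)) h1
    have := mul_le_mul_of_nonneg_left (le_max_left (τ * (e - v)) ((τ - 1) * (e - v))) hs.1
    linarith
  · have := mul_le_mul_of_nonneg_left (le_max_right (τ * e) ((τ - 1) * e)) h1
    have := mul_le_mul_of_nonneg_left (le_max_right (τ * (e - v)) ((τ - 1) * (e - v))) hs.1
    linarith

lemma knightRemainder_nonneg (v e : ℝ) : 0 ≤ knightRemainder v e := by
  unfold knightRemainder; split_ifs <;> exact le_max_right _ _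

lemma knightRemainder_le_abs (v e : ℝ) : knightRemainder v e ≤ |v| := by
  unfold knightRemainder
  split_ifs with h
  · exact max_le (by linarith [le_abs_self v]) (abs_nonneg v)
  · exact max_le (by linarith [neg_abs_le v]) (abs_nonneg v)

/-- No kink lies between e and e - v. Hence only the density of the errors near 0 can enter the
limit. -/
lemma knightRemainder_eq_zero {v e : ℝ} (h : |v| < |e|) : knightRemainder v e = 0 := by
  unfold knightRemainder
  split_ifs with he
  · rw [abs_of_nonneg he] at h
    exact max_eq_right (by linarith [le_abs_self v])
  · rw [abs_of_neg (not_le.1 he)] at h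
    exact max_eq_right (by linarith [neg_abs_le v])

lemma measurable_knightRemainder (v : ℝ) : Measurable (knightRemainder v) := by
  unfold knightRemainder
  exact Measurable.ite measurableSet_Ici (by fun_prop) (by fun_prop)

lemma measurable_checkScore (τ : ℝ) : Measurable (checkScore τ) := by
  unfold checkScore
  exact measurable_const.sub (Measurable.ite measurableSet_Iio measurable_const measurable_const)

lemma abs_checkScore_le_one {τ : ℝ} (hτ : τ ∈ Set.Ioo (0 : ℝ) 1) (e : ℝ) :
    |checkScore τ e| ≤ 1 := by
  unfold checkScore
  rw [abs_le]
  split_ifs <;> constructor <;> linarith [hτ.1, hτ.2]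

lemma abs_knightRemainder_sub_le_abs (v w e : ℝ) :
    |knightRemainder v e - knightRemainder w e| ≤ |v - w| := by
  unfold knightRemainder
  split_ifs
  · simpa using abs_max_sub_max_le_abs (v - e) (w - e) 0
  · refine (abs_max_sub_max_le_abs (e - v) (e - w) 0).trans_eq ?_
    rw [abs_sub_comm v w]; congr 1; ring

/-- The remainder is Lipschitz in its first argument, with a constant that vanishes off the
support of the remainder. -/
lemma abs_knightRemainder_sub_le {a d v w : ℝ} (e : ℝ) (hd : 0 ≤ d) (hv : |v| ≤ a) (hw : |w| ≤ a)
    (hvw : |v - w| ≤ a * d) :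
    |knightRemainder v e - knightRemainder w e| ≤
      d * (knightRemainder (2 * a) e + knightRemainder (-(2 * a)) e) := by
  rcases lt_or_ge a |e| with he | he
  · rw [knightRemainder_eq_zero (hv.trans_lt he), knightRemainder_eq_zero (hw.trans_lt he)]
    simp only [sub_self, abs_zero]
    exact mul_nonneg hd (add_nonneg (knightRemainder_nonneg _ _) (knightRemainder_nonneg _ _))
  -- For |e| ≤ a, one of the remainders at ±2a is at least 2a - |e| ≥ a. Their sum thus majorizes a
  -- on the support, and it is again a quantity whose sums are controlled.
  · refine (abs_knightRemainder_sub_le_abs v w e).trans (hvw.trans ?_)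
    rw [mul_comm]
    refine mul_le_mul_of_nonneg_left ?_ hd
    rw [abs_le] at he
    rcases le_or_gt 0 e with h | h
    · refine le_add_of_le_of_nonneg ?_ (knightRemainder_nonneg _ _)
      unfold knightRemainder
      rw [if_pos h]
      exact le_max_of_le_left (by linarith)
    · refine le_add_of_nonneg_of_le (knightRemainder_nonneg _ _) ?_
      unfold knightRemainder
      rw [if_neg (not_le.2 h)]
      exact le_max_of_le_left (by linarith)

lemma knightRemainder_of_nonneg {v : ℝ} (hv : 0 ≤ v) :
    knightRemainder v = (Set.Icc 0 v).indicator (fun e => v - e) := by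
  ext e
  unfold knightRemainder
  by_cases he : e ∈ Set.Icc 0 v
  · rw [Set.indicator_of_mem he, if_pos he.1, max_eq_left (by linarith [he.2])]
  · rw [Set.indicator_of_notMem he]
    split_ifs with h
    · exact max_eq_right (by by_contra hc; exact he ⟨h, by linarith⟩)
    · exact max_eq_right (by linarith)

lemma knightRemainder_of_neg {v : ℝ} (hv : v < 0) :
    knightRemainder v = (Set.Ico v 0).indicator (fun e => e - v) := by
  ext e
  unfold knightRemainder
  by_cases he : e ∈ Set.Ico v 0
  · rw [Set.indicator_of_mem he, if_neg (not_le.2 he.2), max_eq_left (by linarith [he.1])]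
  · rw [Set.indicator_of_notMem he]
    split_ifs with h
    · exact max_eq_right (by linarith)
    · exact max_eq_right (by by_contra hc; exact he ⟨by linarith, not_le.1 h⟩)

lemma integrable_knightRemainder (v : ℝ) : Integrable (knightRemainder v) := by
  rcases le_or_gt 0 v with hv | hv
  · rw [knightRemainder_of_nonneg hv, integrable_indicator_iff measurableSet_Icc]
    exact (by fun_prop : Continuous fun e : ℝ => v - e).integrableOn_Icc
  · rw [knightRemainder_of_neg hv, integrable_indicator_iff measurableSet_Ico]
    exact (by fun_prop : Continuous fun e : ℝ => e - v).integrableOn_Icc.mono_set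
      Set.Ico_subset_Icc_self

/-- The area of a right triangle with both legs |v|; this is the origin of the quadratic limit. -/
lemma integral_knightRemainder (v : ℝ) : ∫ e, knightRemainder v e = v ^ 2 / 2 := by
  rcases le_or_gt 0 v with hv | hv
  · rw [knightRemainder_of_nonneg hv, integral_indicator measurableSet_Icc,
      integral_Icc_eq_integral_Ioc, ← intervalIntegral.integral_of_le hv,
      intervalIntegral.integral_sub (by simp) (by simp)]
    simp
    ring
  · rw [knightRemainder_of_neg hv, integral_indicator measurableSet_Ico,
      integral_Ico_eq_integral_Ioc, ← intervalIntegral.integral_of_le hv.le,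
      intervalIntegral.integral_sub (by simp) (by simp)]
    simp
    ring

/-! ### Moments of the score and of the remainder -/

section Moments

variable {Ω : Type*} [MeasurableSpace Ω] {P : Measure Ω}
  {ε : ℕ → Ω → ℝ} {f : ℝ → ℝ} {τ : ℝ}

lemma ErrorAssumption.integral_comp (h : ErrorAssumption P ε f τ) (i : ℕ) {k : ℝ → ℝ}
    (hk : Measurable k) : ∫ ω, k (ε i ω) ∂P = ∫ e, f e * k e := by
  have h1 : ∫ ω, k (ε i ω) ∂P = ∫ e, k e ∂(P.map (ε i)) :=
    (integral_map (h.measurable i).aemeasurable hk.aestronglyMeasurable).symm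
  rw [h1, h.law i, integral_withDensity_eq_integral_toReal_smul
    h.density_measurable.ennreal_ofReal (by simp)]
  simp [ENNReal.toReal_ofReal (h.density_nonneg _)]

lemma ErrorAssumption.continuousAt_zero (h : ErrorAssumption P ε f τ) : ContinuousAt f 0 := by
  obtain ⟨M, hM⟩ := h.density_near_zero
  exact hM.self_of_nhds.1

lemma ErrorAssumption.pos_zero (h : ErrorAssumption P ε f τ) : 0 < f 0 := by
  obtain ⟨M, hM⟩ := h.density_near_zero
  exact hM.self_of_nhds.2.1

/-- On the support |e| ≤ |v| the density is within η of f(0), so only continuity at 0 is involved.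
-/
lemma ErrorAssumption.integral_knightRemainder_approx (h : ErrorAssumption P ε f τ) {η : ℝ}
    (hη : 0 < η) : ∃ δ > 0, ∀ v : ℝ, |v| ≤ δ → ∀ i,
      |∫ ω, knightRemainder v (ε i ω) ∂P - f 0 * (v ^ 2 / 2)| ≤ η * v ^ 2 := by
  obtain ⟨δ, hδ, hf⟩ := Metric.continuousAt_iff.1 h.continuousAt_zero η hη
  -- Continuity asks for |e| < δ strictly, whereas the support only gives |e| ≤ |v|.
  refine ⟨δ / 2, by positivity, fun v hv i => ?_⟩
  have hpt : ∀ e, |(f e - f 0) * knightRemainder v e| ≤ η * knightRemainder v e := by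
    intro e
    rw [abs_mul, abs_of_nonneg (knightRemainder_nonneg v e)]
    rcases lt_or_ge |v| |e| with he | he
    · simp [knightRemainder_eq_zero he]
    · refine mul_le_mul_of_nonneg_right ?_ (knightRemainder_nonneg v e)
      have := @hf e (by simp only [dist_zero_right, Real.norm_eq_abs]; linarith)
      exact this.le
  have hint1 : Integrable fun e => (f e - f 0) * knightRemainder v e := by
    refine Integrable.mono' ((integrable_knightRemainder v).const_mul η) ?_
      (ae_of_all _ fun e => by simpa using hpt e)
    exact ((h.density_measurable.sub_const _).mul
      (measurable_knightRemainder v)).aestronglyMeasurable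
  rw [h.integral_comp i (measurable_knightRemainder v), ← integral_knightRemainder,
    ← integral_const_mul]
  have hint2 : Integrable fun e => f 0 * knightRemainder v e :=
    (integrable_knightRemainder v).const_mul _
  have hsplit : (fun e => f e * knightRemainder v e) =
      fun e => (f e - f 0) * knightRemainder v e + f 0 * knightRemainder v e := by
    ext e; ring
  rw [hsplit, integral_add hint1 hint2, add_sub_cancel_right]
  calc |∫ e, (f e - f 0) * knightRemainder v e|
      ≤ ∫ e, |(f e - f 0) * knightRemainder v e| := abs_integral_le_integral_abs
    _ ≤ ∫ e, η * knightRemainder v e :=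
        integral_mono hint1.abs ((integrable_knightRemainder v).const_mul η) hpt
    _ = η * (v ^ 2 / 2) := by rw [integral_const_mul, integral_knightRemainder]
    _ ≤ η * v ^ 2 := by nlinarith [sq_nonneg v]

lemma ErrorAssumption.integral_indicator (h : ErrorAssumption P ε f τ) (i : ℕ) :
    ∫ ω, (if ε i ω < 0 then (1 : ℝ) else 0) ∂P = τ := by
  rw [← h.quantile i, ← integral_indicator_one (measurableSet_lt (h.measurable i) measurable_const)]
  congr

variable [IsProbabilityMeasure P]

lemma ErrorAssumption.integrable_indicator (h : ErrorAssumption P ε f τ) (i : ℕ) :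
    Integrable (fun ω => if ε i ω < 0 then (1 : ℝ) else 0) P := by
  refine Integrable.of_bound (C := 1) (Measurable.aestronglyMeasurable ?_) (ae_of_all _ fun ω => ?_)
  · exact Measurable.ite (measurableSet_lt (h.measurable i) measurable_const) measurable_const
      measurable_const
  · split_ifs <;> simp

lemma ErrorAssumption.integral_checkScore (h : ErrorAssumption P ε f τ) (i : ℕ) :
    ∫ ω, checkScore τ (ε i ω) ∂P = 0 := by
  unfold checkScore
  rw [integral_sub (integrable_const _) (h.integrable_indicator i), h.integral_indicator i]
  simp

lemma ErrorAssumption.integral_checkScore_sq (h : ErrorAssumption P ε f τ) (i : ℕ) :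
    ∫ ω, checkScore τ (ε i ω) ^ 2 ∂P = τ * (1 - τ) := by
  have : ∀ ω, checkScore τ (ε i ω) ^ 2 =
      τ ^ 2 + (1 - 2 * τ) * (if ε i ω < 0 then (1 : ℝ) else 0) := by
    intro ω; unfold checkScore; split_ifs <;> ring
  simp_rw [this]
  rw [integral_add (integrable_const _) ((h.integrable_indicator i).const_mul _),
    integral_const_mul, h.integral_indicator i]
  simp
  ring

end Moments

/-! ### Events whose probability tends to one -/

/-- The probability of the complement of the event `A n` tends to zero. -/
def EventuallyLikely {Ω : Type*} [MeasurableSpace Ω] (P : Measure Ω) (A : ℕ → Ω → Prop) : Prop :=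
  Tendsto (fun n => P {ω | ¬ A n ω}) atTop (𝓝 0)

section Likely

variable {Ω : Type*} [MeasurableSpace Ω] {P : Measure Ω} {A B : ℕ → Ω → Prop}

/-- These rules use only monotonicity and subadditivity of the outer measure, so events about all u
in a ball, or about minimizers, need no measurability proof. -/
lemma EventuallyLikely.mono (hA : EventuallyLikely P A) (h : ∀ᶠ n in atTop, ∀ ω, A n ω → B n ω) :
    EventuallyLikely P B := by
  refine tendsto_of_tendsto_of_tendsto_of_le_of_le' tendsto_const_nhds hA
    (Eventually.of_forall fun _ => zero_le) ?_
  filter_upwards [h] with n hn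
  exact measure_mono fun ω hω hA => hω (hn ω hA)

lemma EventuallyLikely.and (hA : EventuallyLikely P A) (hB : EventuallyLikely P B) :
    EventuallyLikely P (fun n ω => A n ω ∧ B n ω) := by
  have h0 : Tendsto (fun n => P {ω | ¬ A n ω} + P {ω | ¬ B n ω}) atTop (𝓝 0) := by
    simpa using Tendsto.add hA hB
  refine tendsto_of_tendsto_of_tendsto_of_le_of_le tendsto_const_nhds h0
    (fun _ => zero_le) fun n => ?_
  refine (measure_mono fun ω hω => ?_).trans (measure_union_le _ _)
  simp only [Set.mem_ofPred_eq, not_and_or] at hω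
  exact hω

lemma eventuallyLikely_of_forall (h : ∀ n ω, A n ω) : EventuallyLikely P A := by
  simp [EventuallyLikely, h]

lemma eventuallyLikely_of_ae (h : ∀ n, ∀ᵐ ω ∂P, A n ω) : EventuallyLikely P A := by
  have : ∀ n, P {ω | ¬ A n ω} = 0 := fun n => ae_iff.1 (h n)
  simp [EventuallyLikely, this]

lemma EventuallyLikely.forall_mem_finset {ι : Type*} (s : Finset ι) {C : ι → ℕ → Ω → Prop}
    (h : ∀ i ∈ s, EventuallyLikely P (C i)) :
    EventuallyLikely P (fun n ω => ∀ i ∈ s, C i n ω) := by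
  classical
  induction s using Finset.induction_on with
  | empty => exact eventuallyLikely_of_forall (by simp)
  | insert i s _ ih =>
    refine ((h i (by simp)).and (ih fun j hj => h j (by simp [hj]))).mono
      (Eventually.of_forall fun n ω hω => ?_)
    simpa using hω

end Likely

/-! ### Weighted sums of functions of the errors -/

/-- The rows `a n 0, …, a n (n-1)` are uniformly small and their sums of squares converge. -/
structure IsSmallArray (a : ℕ → ℕ → ℝ) (S : ℝ) : Prop where
  max_small : ∀ δ > 0, ∀ᶠ n in atTop, ∀ i < n, |a n i| ≤ δ
  sum_sq : Tendsto (fun n => ∑ i ∈ Finset.range n, (a n i) ^ 2) atTop (𝓝 S)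

section Arrays

variable {Ω : Type*} [MeasurableSpace Ω] {P : Measure Ω} [IsProbabilityMeasure P]
  {ε : ℕ → Ω → ℝ} {f : ℝ → ℝ} {τ : ℝ} {a : ℕ → ℕ → ℝ} {S : ℝ}

lemma ErrorAssumption.memLp_knightRemainder (h : ErrorAssumption P ε f τ) (v : ℝ) (i : ℕ)
    (q : ℝ≥0∞) : MemLp (fun ω => knightRemainder v (ε i ω)) q P := by
  refine MemLp.of_bound
    ((measurable_knightRemainder v).comp (h.measurable i)).aestronglyMeasurable |v|
    (ae_of_all _ fun ω => ?_)
  rw [Real.norm_eq_abs, abs_of_nonneg (knightRemainder_nonneg _ _)]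
  exact knightRemainder_le_abs _ _

lemma ErrorAssumption.memLp_checkScore (h : ErrorAssumption P ε f τ) (hτ : τ ∈ Set.Ioo (0 : ℝ) 1)
    (i : ℕ) (q : ℝ≥0∞) : MemLp (fun ω => checkScore τ (ε i ω)) q P :=
  MemLp.of_bound ((measurable_checkScore τ).comp (h.measurable i)).aestronglyMeasurable 1
    (ae_of_all _ fun _ => abs_checkScore_le_one hτ _)

omit [IsProbabilityMeasure P] in
-- Uniform smallness of the row makes each mean f(0) a²/2 up to an error η' a² with the same η' for
-- all i; bounded sums of squares then control the total error.
lemma IsSmallArray.tendsto_sum_integral_knightRemainder (ha : IsSmallArray a S)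
    (h : ErrorAssumption P ε f τ) :
    Tendsto (fun n => ∑ i ∈ Finset.range n, ∫ ω, knightRemainder (a n i) (ε i ω) ∂P) atTop
      (𝓝 (f 0 * S / 2)) := by
  have hlim : Tendsto (fun n => f 0 / 2 * ∑ i ∈ Finset.range n, (a n i) ^ 2) atTop
      (𝓝 (f 0 * S / 2)) := by
    convert ha.sum_sq.const_mul (f 0 / 2) using 2; ring
  have hdiff : Tendsto (fun n => ∑ i ∈ Finset.range n, ∫ ω, knightRemainder (a n i) (ε i ω) ∂P
      - f 0 / 2 * ∑ i ∈ Finset.range n, (a n i) ^ 2) atTop (𝓝 0) := by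
    rw [Metric.tendsto_nhds]
    intro η hη
    have hS : 0 ≤ S := ge_of_tendsto' ha.sum_sq fun n => Finset.sum_nonneg fun i _ => sq_nonneg _
    -- S + 1 eventually bounds the sums of squares and is positive even if S = 0; the factor 2
    -- leaves a strict inequality.
    obtain ⟨δ, hδ, hk⟩ := h.integral_knightRemainder_approx
      (η := η / (2 * (S + 1))) (by positivity)
    filter_upwards [ha.max_small δ hδ, ha.sum_sq.eventually_lt_const (lt_add_one S)] with n hn hn2
    rw [Real.dist_eq, sub_zero, Finset.mul_sum, ← Finset.sum_sub_distrib]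
    calc |∑ i ∈ Finset.range n, (∫ ω, knightRemainder (a n i) (ε i ω) ∂P - f 0 / 2 * (a n i) ^ 2)|
        ≤ ∑ i ∈ Finset.range n,
            |∫ ω, knightRemainder (a n i) (ε i ω) ∂P - f 0 / 2 * (a n i) ^ 2| :=
          Finset.abs_sum_le_sum_abs _ _
      _ ≤ ∑ i ∈ Finset.range n, η / (2 * (S + 1)) * (a n i) ^ 2 := by
          refine Finset.sum_le_sum fun i hi => ?_
          have := hk (a n i) (hn i (Finset.mem_range.1 hi)) i
          rwa [show f 0 * (a n i ^ 2 / 2) = f 0 / 2 * a n i ^ 2 by ring] at this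
      _ = η / (2 * (S + 1)) * ∑ i ∈ Finset.range n, (a n i) ^ 2 := by rw [Finset.mul_sum]
      _ ≤ η / (2 * (S + 1)) * (S + 1) := by gcongr
      _ = η / 2 := by field_simp
      _ < η := by linarith
  simpa using hdiff.add hlim

/-- By independence and 0 ≤ r ≤ |a|, the variance is at most ∑ E r² ≤ max |a| · ∑ E r, and the sum
of means converges. -/
lemma IsSmallArray.tendsto_variance_sum_knightRemainder (ha : IsSmallArray a S)
    (h : ErrorAssumption P ε f τ) :
    Tendsto (fun n => Var[∑ i ∈ Finset.range n, fun ω => knightRemainder (a n i) (ε i ω); P]) atTop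
      (𝓝 0) := by
  have hm := ha.tendsto_sum_integral_knightRemainder h
  set L := f 0 * S / 2 with hL
  have hL0 : 0 ≤ L := ge_of_tendsto' hm fun n => Finset.sum_nonneg fun i _ =>
    integral_nonneg fun _ => knightRemainder_nonneg _ _
  rw [Metric.tendsto_nhds]
  intro η hη
  filter_upwards [ha.max_small (η / (2 * (L + 1))) (by positivity),
    hm.eventually_lt_const (lt_add_one L)] with n hn hn2
  rw [Real.dist_eq, sub_zero, abs_of_nonneg (variance_nonneg _ _), IndepFun.variance_sum
    (fun i _ => h.memLp_knightRemainder _ i 2)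
    (fun i _ j _ hij => (h.indep.indepFun hij).comp (measurable_knightRemainder _)
      (measurable_knightRemainder _))]
  calc ∑ i ∈ Finset.range n, Var[fun ω => knightRemainder (a n i) (ε i ω); P]
      ≤ ∑ i ∈ Finset.range n,
          η / (2 * (L + 1)) * ∫ ω, knightRemainder (a n i) (ε i ω) ∂P := by
        refine Finset.sum_le_sum fun i hi => ?_
        refine (variance_le_expectation_sq
          ((measurable_knightRemainder _).comp (h.measurable i)).aestronglyMeasurable).trans ?_
        rw [← integral_const_mul]
        refine integral_mono (h.memLp_knightRemainder _ i 2).integrable_sq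
          (((h.memLp_knightRemainder _ i 1).integrable le_rfl).const_mul _) fun ω => ?_
        simp only [Pi.pow_apply]
        rw [sq]
        exact mul_le_mul_of_nonneg_right ((knightRemainder_le_abs _ _).trans
          (hn i (Finset.mem_range.1 hi))) (knightRemainder_nonneg _ _)
    _ = η / (2 * (L + 1)) * ∑ i ∈ Finset.range n, ∫ ω, knightRemainder (a n i) (ε i ω) ∂P := by
        rw [Finset.mul_sum]
    _ ≤ η / (2 * (L + 1)) * (L + 1) := by gcongr
    _ = η / 2 := by field_simp
    _ < η := by linarith

/-- The sum of the remainders converges in probability to `f(0) S / 2`. -/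
lemma IsSmallArray.eventuallyLikely_sum_knightRemainder (ha : IsSmallArray a S)
    (h : ErrorAssumption P ε f τ) {δ : ℝ} (hδ : 0 < δ) :
    EventuallyLikely P (fun n ω =>
      |∑ i ∈ Finset.range n, knightRemainder (a n i) (ε i ω) - f 0 * S / 2| ≤ δ) := by
  have hm := ha.tendsto_sum_integral_knightRemainder h
  have hv := ha.tendsto_variance_sum_knightRemainder h
  -- Half of δ is spent on the fluctuation about the mean, by Chebyshev's inequality, and half on
  -- the distance of the mean from its limit.
  have hv' : Tendsto (fun n => ENNReal.ofReal
      (Var[∑ i ∈ Finset.range n, fun ω => knightRemainder (a n i) (ε i ω); P] / (δ / 2) ^ 2)) atTop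
      (𝓝 0) := by
    simpa using ENNReal.tendsto_ofReal (hv.div_const ((δ / 2) ^ 2))
  refine tendsto_of_tendsto_of_tendsto_of_le_of_le' tendsto_const_nhds hv'
    (Eventually.of_forall fun _ => zero_le) ?_
  filter_upwards [Metric.tendsto_nhds.1 hm (δ / 2) (by positivity)] with n hn
  have hint : ∀ i ∈ Finset.range n, Integrable (fun ω => knightRemainder (a n i) (ε i ω)) P :=
    fun i _ => (h.memLp_knightRemainder _ i 1).integrable le_rfl
  refine (measure_mono fun ω hω => ?_).trans
    (meas_ge_le_variance_div_sq (memLp_finsetSum' _ fun i _ => h.memLp_knightRemainder _ i 2)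
      (half_pos hδ))
  simp only [Set.mem_ofPred_eq, not_le, Finset.sum_apply, integral_finsetSum _ hint] at hω ⊢
  rw [Real.dist_eq] at hn
  by_contra! hc
  have := abs_sub_le (∑ i ∈ Finset.range n, knightRemainder (a n i) (ε i ω))
    (∑ i ∈ Finset.range n, ∫ ω, knightRemainder (a n i) (ε i ω) ∂P) (f 0 * S / 2)
  linarith

/-- Chebyshev's inequality for the weighted sums of the scores. -/
lemma ErrorAssumption.measure_sum_checkScore_ge_le (h : ErrorAssumption P ε f τ)
    (hτ : τ ∈ Set.Ioo (0 : ℝ) 1) (s : Finset ℕ) (b : ℕ → ℝ) {K : ℝ} (hK : 0 < K) :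
    P {ω | K ≤ |∑ i ∈ s, b i * checkScore τ (ε i ω)|} ≤
      ENNReal.ofReal ((∑ i ∈ s, b i ^ 2) / K ^ 2) := by
  have hint : ∀ i ∈ s, Integrable (fun ω => b i * checkScore τ (ε i ω)) P :=
    fun i _ => ((h.memLp_checkScore hτ i 1).integrable le_rfl).const_mul _
  have h0 : ∫ ω, (∑ i ∈ s, fun ω => b i * checkScore τ (ε i ω)) ω ∂P = 0 := by
    simp only [Finset.sum_apply]
    rw [integral_finsetSum _ hint]
    simp [integral_const_mul, h.integral_checkScore]
  have h1 := meas_ge_le_variance_div_sq (μ := P) (X := ∑ i ∈ s, fun ω => b i * checkScore τ (ε i ω))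
    (memLp_finsetSum' _ fun i _ => (h.memLp_checkScore hτ i 2).const_mul _) hK
  rw [h0] at h1
  simp only [Finset.sum_apply, sub_zero] at h1
  refine h1.trans (ENNReal.ofReal_le_ofReal ?_)
  rw [IndepFun.variance_sum (fun i _ => (h.memLp_checkScore hτ i 2).const_mul _)
    (fun i _ j _ hij => (h.indep.indepFun hij).comp ((measurable_checkScore τ).const_mul _)
      ((measurable_checkScore τ).const_mul _))]
  gcongr with i hi
  refine (variance_le_expectation_sq (((measurable_checkScore τ).comp
    (h.measurable i)).const_mul _).aestronglyMeasurable).trans ?_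
  simp only [Pi.pow_apply, Function.comp_apply, mul_pow]
  rw [integral_const_mul, h.integral_checkScore_sq]
  have : τ * (1 - τ) ≤ 1 := by nlinarith [hτ.1, hτ.2]
  nlinarith [sq_nonneg (b i)]

end Arrays

/-! ### Characteristic functions of the weighted sums of the scores -/

/-- Telescoping: replace one factor at a time, all the others having norm at most 1. -/
lemma norm_prod_sub_prod_le {ι : Type*} (s : Finset ι) {u v : ι → ℂ} (hu : ∀ i ∈ s, ‖u i‖ ≤ 1)
    (hv : ∀ i ∈ s, ‖v i‖ ≤ 1) : ‖∏ i ∈ s, u i - ∏ i ∈ s, v i‖ ≤ ∑ i ∈ s, ‖u i - v i‖ := by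
  classical
  induction s using Finset.induction_on with
  | empty => simp
  | insert i s hi ih =>
    rw [Finset.prod_insert hi, Finset.prod_insert hi, Finset.sum_insert hi]
    have h1 : ‖∏ j ∈ s, u j‖ ≤ 1 := by
      rw [norm_prod]
      exact Finset.prod_le_one (fun j _ => norm_nonneg _) fun j hj => hu j (by simp [hj])
    have h2 := ih (fun j hj => hu j (by simp [hj])) (fun j hj => hv j (by simp [hj]))
    calc ‖u i * ∏ j ∈ s, u j - v i * ∏ j ∈ s, v j‖
        = ‖(u i - v i) * ∏ j ∈ s, u j + v i * (∏ j ∈ s, u j - ∏ j ∈ s, v j)‖ := by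
          congr 1; ring
      _ ≤ ‖u i - v i‖ * ‖∏ j ∈ s, u j‖ + ‖v i‖ * ‖∏ j ∈ s, u j - ∏ j ∈ s, v j‖ := by
          refine (norm_add_le _ _).trans_eq ?_
          rw [norm_mul, norm_mul]
      _ ≤ ‖u i - v i‖ * 1 + 1 * ‖∏ j ∈ s, u j - ∏ j ∈ s, v j‖ := by
          gcongr
          exact hv i (by simp)
      _ ≤ ‖u i - v i‖ + ∑ j ∈ s, ‖u j - v j‖ := by linarith

lemma norm_exp_mul_I_sub_le {y : ℝ} (hy : |y| ≤ 1) :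
    ‖Complex.exp (y * Complex.I) - (1 + y * Complex.I - y ^ 2 / 2)‖ ≤ |y| ^ 3 := by
  have hn : ‖(y * Complex.I : ℂ)‖ = |y| := by simp
  have h := Complex.exp_bound (x := y * Complex.I) (by rw [hn]; exact hy) (n := 3) (by norm_num)
  rw [hn] at h
  have he : ∑ m ∈ Finset.range 3, (y * Complex.I : ℂ) ^ m / (m.factorial : ℂ) =
      1 + y * Complex.I - y ^ 2 / 2 := by
    simp [Finset.sum_range_succ, mul_pow]
    ring
  rw [he] at h
  -- The Taylor bound carries the constant 4 / (3! · 3) = 2/9.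
  refine h.trans ?_
  have : 0 ≤ |y| ^ 3 := by positivity
  norm_num [Nat.factorial]
  nlinarith

section CLT

variable {Ω : Type*} [MeasurableSpace Ω] {P : Measure Ω} [IsProbabilityMeasure P]
  {ε : ℕ → Ω → ℝ} {f : ℝ → ℝ} {τ : ℝ} {a : ℕ → ℕ → ℝ} {S : ℝ}

/-- Second-order expansion of the characteristic function: centring removes the linear term, and the
bounded score makes the error cubic. -/
lemma ErrorAssumption.norm_integral_exp_checkScore_sub_le (h : ErrorAssumption P ε f τ)
    (hτ : τ ∈ Set.Ioo (0 : ℝ) 1) (i : ℕ) {s : ℝ} (hs : |s| ≤ 1) :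
    ‖∫ ω, Complex.exp ((s * checkScore τ (ε i ω) : ℝ) * Complex.I) ∂P
      - (1 - ((τ * (1 - τ) * s ^ 2 / 2 : ℝ) : ℂ))‖ ≤ |s| ^ 3 := by
  set y : Ω → ℝ := fun ω => s * checkScore τ (ε i ω) with hy
  have hys : ∀ ω, |y ω| ≤ |s| := fun ω => by
    simp only [hy, abs_mul]
    exact mul_le_of_le_one_right (abs_nonneg s) (abs_checkScore_le_one hτ _)
  have hym : Measurable y := ((measurable_checkScore τ).comp (h.measurable i)).const_mul s
  have hi1 : Integrable (fun ω => (y ω : ℂ)) P :=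
    (((h.memLp_checkScore hτ i 1).integrable le_rfl).const_mul s).ofReal
  have hi2 : Integrable (fun ω => ((y ω) ^ 2 : ℝ)) P :=
    ((h.memLp_checkScore hτ i 2).const_mul s).integrable_sq
  have hi2' : Integrable (fun ω => (y ω : ℂ) ^ 2 / 2) P := by
    have := (hi2.ofReal (𝕜 := ℂ)).div_const 2
    simpa using this
  have hi3 : Integrable (fun ω => 1 + (y ω : ℂ) * Complex.I) P :=
    (integrable_const _).add (hi1.mul_const _)
  have hi4 : Integrable (fun ω => 1 + (y ω : ℂ) * Complex.I - (y ω : ℂ) ^ 2 / 2) P := hi3.sub hi2'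
  have hmain : ∫ ω, (1 + (y ω : ℂ) * Complex.I - (y ω : ℂ) ^ 2 / 2) ∂P =
      1 - ((τ * (1 - τ) * s ^ 2 / 2 : ℝ) : ℂ) := by
    rw [integral_sub hi3 hi2', integral_add (integrable_const _) (hi1.mul_const _),
      integral_mul_const, integral_div, integral_complex_ofReal]
    have e1 : ∫ ω, y ω ∂P = 0 := by
      simp only [hy]; rw [integral_const_mul, h.integral_checkScore]; simp
    have e2 : ∫ ω, (y ω : ℂ) ^ 2 ∂P = ((s ^ 2 * (τ * (1 - τ)) : ℝ) : ℂ) := by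
      have : ∀ ω, (y ω : ℂ) ^ 2 = ((y ω ^ 2 : ℝ) : ℂ) := fun ω => by push_cast; rfl
      simp_rw [this]
      rw [integral_complex_ofReal]
      simp only [hy, mul_pow]
      rw [integral_const_mul, h.integral_checkScore_sq]
    rw [e1, e2]
    simp
    ring
  have hexp : Integrable (fun ω => Complex.exp (y ω * Complex.I)) P := by
    refine Integrable.of_bound (C := 1) (by fun_prop) (ae_of_all _ fun ω => ?_)
    rw [Complex.norm_exp_ofReal_mul_I]
  rw [← hmain, ← integral_sub hexp hi4]
  refine (norm_integral_le_of_norm_le_const (C := |s| ^ 3) (ae_of_all _ fun ω => ?_)).trans_eq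
    (by simp)
  exact (norm_exp_mul_I_sub_le ((hys ω).trans hs)).trans
    (pow_le_pow_left₀ (abs_nonneg _) (hys ω) 3)

/-- The Gaussian factor has the same second-order polynomial, so it differs from the factor of the
score only by a cubic error. -/
lemma norm_exp_neg_sub_le {σ s : ℝ} (hσ : σ ∈ Set.Icc (0 : ℝ) 1) (hs : |s| ≤ 1) :
    ‖Complex.exp (-(σ * s ^ 2 / 2 : ℝ)) - (1 - ((σ * s ^ 2 / 2 : ℝ) : ℂ))‖ ≤ |s| ^ 3 := by
  have hs2 : s ^ 2 ≤ 1 := by rw [← sq_abs]; nlinarith [abs_nonneg s]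
  have h0 : 0 ≤ σ * s ^ 2 / 2 := by have := hσ.1; positivity
  have h1 : σ * s ^ 2 / 2 ≤ s ^ 2 := by nlinarith [hσ.2, sq_nonneg s]
  have hn : ‖(-(σ * s ^ 2 / 2 : ℝ) : ℂ)‖ = σ * s ^ 2 / 2 := by
    rw [norm_neg, Complex.norm_real, Real.norm_of_nonneg h0]
  have h := Complex.norm_exp_sub_one_sub_id_le (x := (-(σ * s ^ 2 / 2 : ℝ) : ℂ))
    (by rw [hn]; linarith)
  rw [hn] at h
  have he : Complex.exp (-(σ * s ^ 2 / 2 : ℝ)) - (1 - ((σ * s ^ 2 / 2 : ℝ) : ℂ)) =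
      Complex.exp (-(σ * s ^ 2 / 2 : ℝ)) - 1 - -((σ * s ^ 2 / 2 : ℝ) : ℂ) := by ring
  rw [he]
  refine h.trans ?_
  calc (σ * s ^ 2 / 2) ^ 2 ≤ (s ^ 2) ^ 2 := pow_le_pow_left₀ h0 h1 2
    _ = |s| ^ 4 := by rw [← sq_abs s]; ring
    _ ≤ |s| ^ 3 := pow_le_pow_of_le_one (abs_nonneg s) hs (by norm_num)

omit [IsProbabilityMeasure P] in
lemma ErrorAssumption.charFun_sum_checkScore (h : ErrorAssumption P ε f τ) (s : Finset ℕ)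
    (b : ℕ → ℝ) :
    charFun (P.map (fun ω => ∑ i ∈ s, b i * checkScore τ (ε i ω))) 1 =
      ∏ i ∈ s, ∫ ω, Complex.exp ((b i * checkScore τ (ε i ω) : ℝ) * Complex.I) ∂P := by
  have hm : ∀ i, Measurable (fun ω => b i * checkScore τ (ε i ω)) := fun i =>
    ((measurable_checkScore τ).comp (h.measurable i)).const_mul _
  have hind : iIndepFun (fun i ω => b i * checkScore τ (ε i ω)) P :=
    h.indep.comp (fun i e => b i * checkScore τ e) fun i => (measurable_checkScore τ).const_mul _
  rw [(hind.restrict s).charFun_map_fun_finsetSum_eq_prod fun i _ => (hm i).aemeasurable,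
    Finset.prod_apply]
  refine Finset.prod_congr rfl fun i _ => ?_
  rw [charFun_apply_real, integral_map (hm i).aemeasurable (by fun_prop)]
  simp

/-- Central limit theorem for the weighted sums of the scores, in terms of characteristic
functions. -/
lemma IsSmallArray.tendsto_charFun_sum_checkScore (ha : IsSmallArray a S)
    (h : ErrorAssumption P ε f τ) (hτ : τ ∈ Set.Ioo (0 : ℝ) 1) :
    Tendsto (fun n => charFun
      (P.map (fun ω => ∑ i ∈ Finset.range n, a n i * checkScore τ (ε i ω))) 1) atTop
      (𝓝 (Complex.exp (-(τ * (1 - τ) * S / 2 : ℝ)))) := by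
  have hσ : τ * (1 - τ) ∈ Set.Icc (0 : ℝ) 1 := by
    constructor <;> nlinarith [hτ.1, hτ.2]
  have hS : 0 ≤ S := ge_of_tendsto' ha.sum_sq fun n => Finset.sum_nonneg fun i _ => sq_nonneg _
  have hlim : Tendsto (fun n => ∏ i ∈ Finset.range n,
      Complex.exp (-(τ * (1 - τ) * (a n i) ^ 2 / 2 : ℝ))) atTop
      (𝓝 (Complex.exp (-(τ * (1 - τ) * S / 2 : ℝ)))) := by
    have h1 : Tendsto (fun n => -(τ * (1 - τ) * (∑ i ∈ Finset.range n, (a n i) ^ 2) / 2)) atTop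
        (𝓝 (-(τ * (1 - τ) * S / 2))) := ((ha.sum_sq.const_mul _).div_const 2).neg
    have h2 := (Complex.continuous_exp.comp Complex.continuous_ofReal).tendsto _ |>.comp h1
    refine Tendsto.congr (fun n => ?_) (by simpa using h2)
    simp only [Function.comp_apply]
    rw [← Complex.exp_sum]
    congr 1
    push_cast
    rw [Finset.sum_neg_distrib, ← Finset.sum_div, ← Finset.mul_sum]
  have hdiff : Tendsto (fun n => charFun
      (P.map (fun ω => ∑ i ∈ Finset.range n, a n i * checkScore τ (ε i ω))) 1 -
      ∏ i ∈ Finset.range n, Complex.exp (-(τ * (1 - τ) * (a n i) ^ 2 / 2 : ℝ))) atTop (𝓝 0) := by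
    rw [Metric.tendsto_nhds]
    intro η hη
    filter_upwards [ha.max_small 1 one_pos, ha.max_small (η / (4 * (S + 1))) (by positivity),
      ha.sum_sq.eventually_lt_const (lt_add_one S)] with n hn1 hn2 hn3
    rw [dist_zero_right, h.charFun_sum_checkScore]
    refine (norm_prod_sub_prod_le _ (fun i _ => ?_) fun i _ => ?_).trans_lt ?_
    · refine (norm_integral_le_of_norm_le_const (C := 1) (ae_of_all _ fun ω => ?_)).trans_eq
        (by simp)
      rw [Complex.norm_exp_ofReal_mul_I]
    · rw [← Complex.ofReal_neg, Complex.norm_exp_ofReal, Real.exp_le_one_iff]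
      have := hσ.1
      have : 0 ≤ τ * (1 - τ) * a n i ^ 2 / 2 := by positivity
      linarith
    · calc _ ≤ ∑ i ∈ Finset.range n, 2 * (η / (4 * (S + 1))) * (a n i) ^ 2 := by
            refine Finset.sum_le_sum fun i hi => ?_
            have hi1 := hn1 i (Finset.mem_range.1 hi)
            have hi2 := hn2 i (Finset.mem_range.1 hi)
            have e1 := h.norm_integral_exp_checkScore_sub_le hτ i hi1
            have e2 := norm_exp_neg_sub_le hσ hi1
            -- The Lindeberg step: a cubic error is at most max |a| times a square, and the squares
            -- are summable uniformly in n. Two such errors occur, which accounts for the 4 in the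
            -- threshold.
            have e3 : |a n i| ^ 3 ≤ η / (4 * (S + 1)) * (a n i) ^ 2 := by
              rw [← sq_abs (a n i), pow_succ']
              gcongr
            have e4 := norm_sub_le_norm_sub_add_norm_sub
              (∫ ω, Complex.exp ((a n i * checkScore τ (ε i ω) : ℝ) * Complex.I) ∂P)
              (1 - ((τ * (1 - τ) * (a n i) ^ 2 / 2 : ℝ) : ℂ))
              (Complex.exp (-(τ * (1 - τ) * (a n i) ^ 2 / 2 : ℝ)))
            rw [norm_sub_rev (1 - ((τ * (1 - τ) * (a n i) ^ 2 / 2 : ℝ) : ℂ))] at e4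
            linarith
        _ = 2 * (η / (4 * (S + 1))) * ∑ i ∈ Finset.range n, (a n i) ^ 2 := by rw [Finset.mul_sum]
        _ ≤ 2 * (η / (4 * (S + 1))) * (S + 1) := by gcongr
        _ = η / 2 := by field_simp; ring
        _ < η := by linarith
  simpa using hdiff.add hlim

end CLT

/-! ### Arrays built from the design -/

section Design

variable {g p : ℕ} {x : ℕ → Param g p} {U : Matrix (Fin g × Fin p) (Fin g × Fin p) ℝ}

lemma DesignAssumption.norm_small (h : DesignAssumption x U) {δ : ℝ} (hδ : 0 < δ) :
    ∀ᶠ n : ℕ in atTop, ∀ i < n, ‖x i‖ / √(n : ℝ) ≤ δ := by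
  filter_upwards [h.max_tendsto.eventually_lt_const (show (0 : ℝ) < δ ^ 2 by positivity),
    eventually_gt_atTop 0] with n hn hn0 i hi
  have hn0' : (0 : ℝ) < n := by exact_mod_cast hn0
  have h1 : inner ℝ (x i) (x i) ≤ ⨆ i : Fin n, inner ℝ (x i) (x i) :=
    le_ciSup (f := fun i : Fin n => inner ℝ (x i) (x i)) (Set.finite_range _).bddAbove ⟨i, hi⟩
  rw [real_inner_self_eq_norm_sq] at h1
  refine (sq_le_sq₀ (by positivity) hδ.le).1 ?_
  rw [div_pow, Real.sq_sqrt hn0'.le, div_eq_inv_mul]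
  exact (mul_le_mul_of_nonneg_left h1 (by positivity)).trans hn.le

lemma DesignAssumption.tendsto_entry (h : DesignAssumption x U) (q r : Fin g × Fin p) :
    Tendsto (fun n : ℕ => (n : ℝ)⁻¹ * ∑ i ∈ Finset.range n, x i q * x i r) atTop (𝓝 (U q r)) := by
  have h1 := (tendsto_pi_nhds.1 ((tendsto_pi_nhds.1 h.gram_tendsto) q)) r
  refine h1.congr fun n => ?_
  simp [Matrix.sum_apply, Matrix.vecMulVec_apply]

/-- Cauchy–Schwarz reduces smallness to that of ‖x_i‖/√n; expanding the square turns the sum into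
the quadratic form of the Gram matrix. -/
lemma DesignAssumption.isSmallArray_inner (h : DesignAssumption x U) (u : Param g p) :
    IsSmallArray (fun n i => inner ℝ (x i) u / √(n : ℝ)) (u.ofLp ⬝ᵥ U.mulVec u.ofLp) where
  max_small δ hδ := by
    filter_upwards [h.norm_small (δ := δ / (‖u‖ + 1)) (by positivity)] with n hn i hi
    rw [abs_div, abs_of_nonneg (Real.sqrt_nonneg _)]
    calc |inner ℝ (x i) u| / √(n : ℝ) ≤ ‖x i‖ * ‖u‖ / √(n : ℝ) := by
          gcongr; exact abs_real_inner_le_norm _ _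
      _ = ‖x i‖ / √(n : ℝ) * ‖u‖ := by ring
      _ ≤ δ / (‖u‖ + 1) * (‖u‖ + 1) := by
          have := hn i hi
          gcongr
          linarith
      _ = δ := by field_simp
  sum_sq := by
    have h1 : Tendsto (fun n : ℕ => ∑ q, ∑ r, u q * u r *
        ((n : ℝ)⁻¹ * ∑ i ∈ Finset.range n, x i q * x i r)) atTop
        (𝓝 (∑ q, ∑ r, u q * u r * U q r)) :=
      tendsto_finsetSum _ fun q _ => tendsto_finsetSum _ fun r _ =>
        (h.tendsto_entry q r).const_mul _
    have e1 : ∑ q, ∑ r, u q * u r * U q r = u.ofLp ⬝ᵥ U.mulVec u.ofLp := by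
      simp only [dotProduct, Matrix.mulVec, Finset.mul_sum]
      exact Finset.sum_congr rfl fun q _ => Finset.sum_congr rfl fun r _ => by ring
    rw [← e1]
    refine h1.congr fun n => ?_
    have e2 : ∀ i, (inner ℝ (x i) u / √(n : ℝ)) ^ 2 =
        ∑ q, ∑ r, u q * u r * ((n : ℝ)⁻¹ * (x i q * x i r)) := by
      intro i
      rw [div_pow, Real.sq_sqrt (Nat.cast_nonneg n), PiLp.inner_apply, sq, Finset.sum_mul_sum,
        div_eq_inv_mul, Finset.mul_sum]
      refine Finset.sum_congr rfl fun q _ => ?_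
      rw [Finset.mul_sum]
      refine Finset.sum_congr rfl fun r _ => ?_
      simp only [RCLike.inner_apply, conj_trivial]
      ring
    simp_rw [e2]
    rw [Finset.sum_comm (s := Finset.range n)]
    refine Finset.sum_congr rfl fun q _ => ?_
    rw [Finset.sum_comm (s := Finset.range n)]
    simp_rw [Finset.mul_sum]

/-- This array does not depend on the direction u, so it supplies the majorant behind uniform
convergence on balls. -/
lemma DesignAssumption.isSmallArray_norm (h : DesignAssumption x U) (c : ℝ) :
    IsSmallArray (fun n i => c * (‖x i‖ / √(n : ℝ))) (c ^ 2 * U.trace) where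
  max_small δ hδ := by
    filter_upwards [h.norm_small (δ := δ / (|c| + 1)) (by positivity)] with n hn i hi
    have h0 : 0 ≤ ‖x i‖ / √(n : ℝ) := by positivity
    rw [abs_mul, abs_of_nonneg h0]
    calc |c| * (‖x i‖ / √(n : ℝ)) ≤ (|c| + 1) * (δ / (|c| + 1)) := by
          have := hn i hi
          gcongr
          linarith
      _ = δ := by field_simp
  sum_sq := by
    have h1 : Tendsto (fun n : ℕ => c ^ 2 * ∑ q,
        ((n : ℝ)⁻¹ * ∑ i ∈ Finset.range n, x i q * x i q)) atTop (𝓝 (c ^ 2 * U.trace)) :=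
      (tendsto_finsetSum _ fun q _ => h.tendsto_entry q q).const_mul _
    refine h1.congr fun n => ?_
    have e2 : ∀ i, (c * (‖x i‖ / √(n : ℝ))) ^ 2 =
        c ^ 2 * ∑ q, (n : ℝ)⁻¹ * (x i q * x i q) := by
      intro i
      rw [mul_pow, div_pow, Real.sq_sqrt (Nat.cast_nonneg n), EuclideanSpace.real_norm_sq_eq,
        div_eq_inv_mul, Finset.mul_sum]
      simp only [sq]
    simp_rw [e2, ← Finset.mul_sum]
    rw [Finset.sum_comm]

end Design

/-! ### The rescaled quantile process -/

section RescaledProcess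

variable {g p : ℕ} {Ω : Type*} [MeasurableSpace Ω] {P : Measure Ω} [IsProbabilityMeasure P]
  {ε Y : ℕ → Ω → ℝ} {f : ℝ → ℝ} {τ : ℝ}
  {x : ℕ → Param g p} {β₀ : Param g p} {U : Matrix (Fin g × Fin p) (Fin g × Fin p) ℝ}

/-- The normalized sum `n^{-1/2} ∑ x_i (τ - 1_{e_i < 0})`. -/
noncomputable def scoreSum (τ : ℝ) (x : ℕ → Param g p) (e : ℕ → ℝ) (n : ℕ) : Param g p :=
  ∑ i ∈ Finset.range n, (checkScore τ (e i) / √(n : ℝ)) • x i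

/-- The sum of the remainders of the rescaled quantile process. -/
noncomputable def remainderSum (x : ℕ → Param g p) (e : ℕ → ℝ) (n : ℕ) (u : Param g p) : ℝ :=
  ∑ i ∈ Finset.range n, knightRemainder (inner ℝ (x i) u / √(n : ℝ)) (e i)

lemma inner_scoreSum (e : ℕ → ℝ) (n : ℕ) (u : Param g p) :
    inner ℝ (scoreSum τ x e n) u =
      ∑ i ∈ Finset.range n, inner ℝ (x i) u / √(n : ℝ) * checkScore τ (e i) := by
  rw [scoreSum, sum_inner]
  refine Finset.sum_congr rfl fun i _ => ?_
  rw [real_inner_smul_left]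
  ring

/-- Knight's identity for the quantile process. -/
lemma quantileProcess_sub {e y : ℕ → ℝ} (hy : ∀ i, y i = inner ℝ (x i) β₀ + e i) (n : ℕ)
    (u : Param g p) :
    quantileProcess τ x y n (β₀ + (√(n : ℝ))⁻¹ • u) - quantileProcess τ x y n β₀ =
      -inner ℝ (scoreSum τ x e n) u + remainderSum x e n u := by
  rw [inner_scoreSum, remainderSum, quantileProcess, quantileProcess, ← Finset.sum_sub_distrib,
    ← Finset.sum_neg_distrib, ← Finset.sum_add_distrib]
  refine Finset.sum_congr rfl fun i _ => ?_
  have h1 : y i - inner ℝ (x i) (β₀ + (√(n : ℝ))⁻¹ • u) = e i - inner ℝ (x i) u / √(n : ℝ) := by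
    rw [hy, inner_add_right, real_inner_smul_right]; ring
  have h2 : y i - inner ℝ (x i) β₀ = e i := by rw [hy]; ring
  rw [h1, h2, checkLoss_sub]
  ring

lemma quantileProcess_nonneg (hτ : τ ∈ Set.Ioo (0 : ℝ) 1) (y : ℕ → ℝ) (n : ℕ) (b : Param g p) :
    0 ≤ quantileProcess τ x y n b :=
  Finset.sum_nonneg fun _ _ => checkLoss_nonneg hτ _

lemma quantileProcess_convex_ray (y : ℕ → ℝ) (n : ℕ) (b v : Param g p) {s : ℝ}
    (hs : s ∈ Set.Icc (0 : ℝ) 1) :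
    quantileProcess τ x y n (b + s • v) - quantileProcess τ x y n b ≤
      s * (quantileProcess τ x y n (b + v) - quantileProcess τ x y n b) := by
  rw [quantileProcess, quantileProcess, quantileProcess, ← Finset.sum_sub_distrib,
    ← Finset.sum_sub_distrib, Finset.mul_sum]
  refine Finset.sum_le_sum fun i _ => ?_
  have h := checkLoss_sub_mul_le τ (y i - inner ℝ (x i) b) (inner ℝ (x i) v) hs
  have h1 : y i - inner ℝ (x i) (b + s • v) = y i - inner ℝ (x i) b - s * inner ℝ (x i) v := by
    rw [inner_add_right, real_inner_smul_right]; ring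
  have h2 : y i - inner ℝ (x i) (b + v) = y i - inner ℝ (x i) b - inner ℝ (x i) v := by
    rw [inner_add_right]; ring
  rw [h1, h2]
  linarith

/-- By Cauchy–Schwarz, one random Lipschitz constant serves the whole ball of radius K: termwise,
the bound for single remainders applies with a = K‖x_i‖/√n. -/
lemma abs_remainderSum_sub_le (e : ℕ → ℝ) (n : ℕ) {K d : ℝ} (hd : 0 ≤ d)
    {u v : Param g p} (hu : ‖u‖ ≤ K) (hv : ‖v‖ ≤ K) (huv : ‖u - v‖ ≤ K * d) :
    |remainderSum x e n u - remainderSum x e n v| ≤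
      d * (∑ i ∈ Finset.range n, knightRemainder (2 * K * (‖x i‖ / √(n : ℝ))) (e i) +
        ∑ i ∈ Finset.range n, knightRemainder (-(2 * K) * (‖x i‖ / √(n : ℝ))) (e i)) := by
  have hin : ∀ (i : ℕ) (w : Param g p) (c : ℝ), ‖w‖ ≤ c →
      |inner ℝ (x i) w / √(n : ℝ)| ≤ c * (‖x i‖ / √(n : ℝ)) := by
    intro i w c hw
    rw [abs_div, abs_of_nonneg (Real.sqrt_nonneg _), mul_div_assoc', mul_comm c]
    gcongr
    exact (abs_real_inner_le_norm _ _).trans (by gcongr)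
  rw [remainderSum, remainderSum, ← Finset.sum_sub_distrib, ← Finset.sum_add_distrib,
    Finset.mul_sum]
  refine (Finset.abs_sum_le_sum_abs _ _).trans (Finset.sum_le_sum fun i _ => ?_)
  have := abs_knightRemainder_sub_le (e i) hd (hin i u K hu) (hin i v K hv) (by
    rw [← sub_div, ← inner_sub_right]
    refine (hin i _ _ huv).trans_eq ?_
    ring)
  rwa [← mul_assoc, ← neg_mul] at this

/-- The limit `f(0)/2 uᵗ U u` of the remainders. -/
noncomputable def limitForm (c : ℝ) (U : Matrix (Fin g × Fin p) (Fin g × Fin p) ℝ)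
    (u : Param g p) : ℝ := c * (u.ofLp ⬝ᵥ U.mulVec u.ofLp) / 2

lemma continuous_limitForm (c : ℝ) (U : Matrix (Fin g × Fin p) (Fin g × Fin p) ℝ) :
    Continuous (limitForm c U) := by
  unfold limitForm dotProduct Matrix.mulVec dotProduct
  fun_prop

/-- The remainders converge in probability uniformly on every ball. -/
lemma DesignAssumption.eventuallyLikely_remainderSum (hx : DesignAssumption x U)
    (h : ErrorAssumption P ε f τ) {K δ : ℝ} (hK : 0 < K) (hδ : 0 < δ) :
    EventuallyLikely P (fun n ω => ∀ u : Param g p, ‖u‖ ≤ K →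
      |remainderSum x (fun i => ε i ω) n u - limitForm (f 0) U u| ≤ δ) := by
  -- The two majorant sums have the common limit f(0)(2K)² tr U / 2; each is allowed an excess of 1.
  set M : ℝ := 2 * (f 0 * ((2 * K) ^ 2 * U.trace) / 2 + 1) with hM
  have hcomp : IsCompact (Metric.closedBall (0 : Param g p) K) := isCompact_closedBall _ _
  have huc := hcomp.uniformContinuousOn_of_continuous (continuous_limitForm (f 0) U).continuousOn
  obtain ⟨r, hr, hrQ⟩ := Metric.uniformContinuousOn_iff_le.1 huc (δ / 3) (by positivity)
  set d : ℝ := δ / (3 * (|M| + 1)) with hd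
  have hd0 : 0 < d := by positivity
  -- A finite net reduces uniformity to pointwise convergence. Mesh r makes the limit vary by at
  -- most δ/3, and mesh K d does so for the remainder sum.
  obtain ⟨t, htK, htf, ht⟩ := hcomp.finite_cover_balls (e := min r (K * d)) (by positivity)
  have hL1 := (hx.isSmallArray_norm (2 * K)).eventuallyLikely_sum_knightRemainder h one_pos
  have hL2 := (hx.isSmallArray_norm (-(2 * K))).eventuallyLikely_sum_knightRemainder h one_pos
  have hL3 : EventuallyLikely P (fun n ω => ∀ u ∈ htf.toFinset,
      |remainderSum x (fun i => ε i ω) n u - limitForm (f 0) U u| ≤ δ / 3) :=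
    EventuallyLikely.forall_mem_finset _ fun u _ =>
      (hx.isSmallArray_inner u).eventuallyLikely_sum_knightRemainder h (by positivity)
  refine (hL1.and (hL2.and hL3)).mono (Eventually.of_forall fun n ω ⟨h1, h2, h3⟩ u hu => ?_)
  have huB : u ∈ Metric.closedBall (0 : Param g p) K := by simpa using hu
  obtain ⟨v, hv, huv⟩ := Set.mem_iUnion₂.1 (ht huB)
  rw [Metric.mem_ball, lt_min_iff] at huv
  have hvK : ‖v‖ ≤ K := by simpa using htK hv
  have e1 := abs_remainderSum_sub_le (x := x) (fun i => ε i ω) n hd0.le hu hvK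
    (by rw [← dist_eq_norm]; exact huv.2.le)
  have e2 := h3 v (by simpa using hv)
  have e3 := hrQ u huB v (htK hv) huv.1.le
  rw [Real.dist_eq] at e3
  have e4 : d * (∑ i ∈ Finset.range n, knightRemainder (2 * K * (‖x i‖ / √(n : ℝ))) (ε i ω) +
        ∑ i ∈ Finset.range n, knightRemainder (-(2 * K) * (‖x i‖ / √(n : ℝ))) (ε i ω)) ≤ δ / 3 := by
    have f1 := (abs_le.1 h1).2
    have f2 := (abs_le.1 h2).2
    rw [neg_sq] at f2
    calc _ ≤ d * (|M| + 1) := by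
          refine mul_le_mul_of_nonneg_left ?_ hd0.le
          have := le_abs_self M
          rw [hM] at this ⊢
          linarith
      _ = δ / 3 := by rw [hd]; field_simp
  rw [abs_le] at *
  constructor <;> linarith [e1.1, e1.2, e2.1, e2.2, e3.1, e3.2]

/-- The normalized score sums are bounded in probability. -/
lemma DesignAssumption.scoreSum_tight (hx : DesignAssumption x U)
    (h : ErrorAssumption P ε f τ) (hτ : τ ∈ Set.Ioo (0 : ℝ) 1) {η : ℝ} (hη : 0 < η) :
    ∃ K > 0, ∀ᶠ n in atTop,
      P {ω | ¬ ‖scoreSum τ x (fun i => ε i ω) n‖ ≤ K} ≤ ENNReal.ofReal η := by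
  -- Union bound over coordinates: C eventually dominates every coordinate's sum of squares, and k
  -- is chosen so that m C / k² = η. The added 1 keeps m positive when there are no coordinates.
  set m : ℝ := (Fintype.card (Fin g × Fin p) : ℝ) + 1 with hm
  have hm0 : 0 < m := by positivity
  set e : Fin g × Fin p → Param g p := fun q => EuclideanSpace.single q 1 with he
  set C : ℝ := ∑ q, |(e q).ofLp ⬝ᵥ U.mulVec (e q).ofLp| + 1 with hC
  have hC0 : 0 < C := by positivity
  set k : ℝ := √(m * C / η) with hk
  have hk0 : 0 < k := Real.sqrt_pos.2 (by positivity)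
  have hk2 : k ^ 2 = m * C / η := Real.sq_sqrt (by positivity)
  refine ⟨m * k, by positivity, ?_⟩
  have hev : ∀ᶠ n in atTop, ∀ q,
      ∑ i ∈ Finset.range n, (inner ℝ (x i) (e q) / √(n : ℝ)) ^ 2 < C := by
    rw [eventually_all]
    intro q
    refine (hx.isSmallArray_inner (e q)).sum_sq.eventually_lt_const ?_
    have := Finset.single_le_sum (f := fun q => |(e q).ofLp ⬝ᵥ U.mulVec (e q).ofLp|)
      (fun _ _ => abs_nonneg _) (Finset.mem_univ q)
    have := le_abs_self ((e q).ofLp ⬝ᵥ U.mulVec (e q).ofLp)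
    simp only at *
    linarith
  filter_upwards [hev] with n hn
  have hsub : {ω | ¬ ‖scoreSum τ x (fun i => ε i ω) n‖ ≤ m * k} ⊆
      ⋃ q, {ω | k ≤ |∑ i ∈ Finset.range n,
        inner ℝ (x i) (e q) / √(n : ℝ) * checkScore τ (ε i ω)|} := by
    intro ω hω
    by_contra hc
    simp only [Set.mem_iUnion, Set.mem_ofPred_eq, not_exists, not_le, ← inner_scoreSum] at hc
    refine hω ?_
    have hsum : scoreSum τ x (fun i => ε i ω) n =
        ∑ q, (inner ℝ (scoreSum τ x (fun i => ε i ω) n) (e q)) • e q := by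
      ext r
      simp [he, Finset.sum_apply, Pi.single_apply, EuclideanSpace.inner_single_right]
    rw [hsum]
    refine (norm_sum_le _ _).trans ?_
    calc ∑ q, ‖inner ℝ (scoreSum τ x (fun i => ε i ω) n) (e q) • e q‖
        ≤ ∑ q : Fin g × Fin p, k := by
          refine Finset.sum_le_sum fun q _ => ?_
          rw [norm_smul, Real.norm_eq_abs]
          simpa [he] using (hc q).le
      _ = Fintype.card (Fin g × Fin p) * k := by simp
      _ ≤ m * k := by gcongr; linarith
  calc P {ω | ¬ ‖scoreSum τ x (fun i => ε i ω) n‖ ≤ m * k}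
      ≤ ∑ q, P {ω | k ≤ |∑ i ∈ Finset.range n,
          inner ℝ (x i) (e q) / √(n : ℝ) * checkScore τ (ε i ω)|} :=
        (measure_mono hsub).trans (measure_iUnion_fintype_le _ _)
    _ ≤ ∑ _q : Fin g × Fin p, ENNReal.ofReal (C / k ^ 2) := by
        refine Finset.sum_le_sum fun q _ => (h.measure_sum_checkScore_ge_le hτ _ _ hk0).trans ?_
        have := (hn q).le
        gcongr
    _ = ENNReal.ofReal (Fintype.card (Fin g × Fin p) * (C / k ^ 2)) := by
        rw [ENNReal.ofReal_mul (by positivity)]; simp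
    _ ≤ ENNReal.ofReal η := by
        refine ENNReal.ofReal_le_ofReal ?_
        rw [hk2]
        calc (Fintype.card (Fin g × Fin p) : ℝ) * (C / (m * C / η))
            ≤ m * (C / (m * C / η)) := by gcongr; linarith
          _ = η := by field_simp

end RescaledProcess

/-! ### The penalty as a real function -/

section Penalty

variable {g p : ℕ}

lemma block_add (a b : Param g p) (j : Fin g) : block (a + b) j = block a j + block b j := rfl

lemma block_sub (a b : Param g p) (j : Fin g) : block (a - b) j = block a j - block b j := rfl

lemma block_smul (s : ℝ) (b : Param g p) (j : Fin g) : block (s • b) j = s • block b j := rfl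

lemma block_zero (j : Fin g) : block (0 : Param g p) j = 0 := rfl

lemma norm_block_le (b : Param g p) (j : Fin g) : ‖block b j‖ ≤ ‖b‖ := by
  refine (sq_le_sq₀ (norm_nonneg _) (norm_nonneg _)).1 ?_
  rw [EuclideanSpace.real_norm_sq_eq, EuclideanSpace.real_norm_sq_eq, Fintype.sum_prod_type]
  exact Finset.single_le_sum (f := fun j => ∑ k, b (j, k) ^ 2)
    (fun j _ => Finset.sum_nonneg fun k _ => sq_nonneg _) (Finset.mem_univ j)

lemma abs_apply_le_norm_block (b : Param g p) (q : Fin g × Fin p) : |b q| ≤ ‖block b q.1‖ :=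
  EuclideanSpace.norm_eq (block b q.1) ▸ (by
    refine Real.le_sqrt_of_sq_le ?_
    exact Finset.single_le_sum (f := fun k => ‖block b q.1 k‖ ^ 2) (fun k _ => sq_nonneg _)
      (Finset.mem_univ q.2))

/-- The penalty with real weights, where a group of infinite weight is ignored. -/
noncomputable def penalty (γ : ℝ) (l₁ l₂ : ℝ≥0) (bt b : Param g p) : ℝ :=
  l₁ * ∑ j, ‖block bt j‖ ^ (-γ) * ‖block b j‖ + l₂ * ∑ j, ‖block b j‖ ^ 2

lemma penalty_nonneg (γ : ℝ) (l₁ l₂ : ℝ≥0) (bt b : Param g p) : 0 ≤ penalty γ l₁ l₂ bt b := by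
  unfold penalty
  positivity

variable {τ γ : ℝ} {l₁ l₂ : ℝ≥0} {x : ℕ → Param g p} {y : ℕ → ℝ} {n : ℕ} {bt b h β : Param g p}

/-- Wherever the weight is infinite the block of `b` vanishes, so ∞ * 0 = 0 applies and the value of
the real power at 0 is irrelevant. -/
lemma elasticNetProcess_eq_ofReal (hτ : τ ∈ Set.Ioo (0 : ℝ) 1)
    (hb : ∀ j, block bt j = 0 → block b j = 0) :
    elasticNetProcess τ γ l₁ l₂ x y n bt b =
      ENNReal.ofReal (quantileProcess τ x y n b + penalty γ l₁ l₂ bt b) := by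
  have hw : ∀ j, adaptiveWeight γ bt j * ENNReal.ofReal ‖block b j‖ =
      ENNReal.ofReal (‖block bt j‖ ^ (-γ) * ‖block b j‖) := by
    intro j
    by_cases hj : block bt j = 0
    · simp [hb j hj]
    · rw [adaptiveWeight, ENNReal.ofReal_rpow_of_pos (norm_pos_iff.2 hj),
        ENNReal.ofReal_mul (by positivity)]
  rw [elasticNetProcess, penalty, ENNReal.ofReal_add (quantileProcess_nonneg hτ y n b)
    (by positivity), ENNReal.ofReal_add (by positivity) (by positivity),
    ENNReal.ofReal_mul (NNReal.coe_nonneg l₁), ENNReal.ofReal_mul (NNReal.coe_nonneg l₂),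
    ENNReal.ofReal_sum_of_nonneg fun j _ => by positivity,
    ENNReal.ofReal_sum_of_nonneg fun j _ => by positivity]
  simp_rw [hw, ENNReal.ofReal_coe_nnreal, add_assoc]

lemma elasticNetProcess_eq_top (hγ : 0 < γ) (hl : 0 < l₁) {j : Fin g} (hj : block bt j = 0)
    (hbj : block b j ≠ 0) : elasticNetProcess τ γ l₁ l₂ x y n bt b = ∞ := by
  have hw : adaptiveWeight γ bt j * ENNReal.ofReal ‖block b j‖ = ∞ := by
    rw [adaptiveWeight, hj, norm_zero, ENNReal.ofReal_zero, ENNReal.zero_rpow_of_neg (by linarith),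
      ENNReal.top_mul (by simpa using hbj)]
  have hs : ∑ j, adaptiveWeight γ bt j * ENNReal.ofReal ‖block b j‖ = ∞ :=
    ENNReal.sum_eq_top.2 ⟨j, Finset.mem_univ j, hw⟩
  rw [elasticNetProcess, hs, ENNReal.mul_top (by simpa using hl.ne')]
  simp

/-- The competitor 0 has finite cost, so a minimizer cannot use a group of infinite weight.
Positivity of `l₁` prevents 0 * ∞ = 0 from hiding that weight. -/
lemma IsElasticNetEstimate.block_eq_zero (hτ : τ ∈ Set.Ioo (0 : ℝ) 1) (hγ : 0 < γ) (hl : 0 < l₁)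
    (hh : IsElasticNetEstimate τ γ l₁ l₂ x y n bt h) (j : Fin g) (hj : block bt j = 0) :
    block h j = 0 := by
  by_contra hc
  have h1 := hh 0
  rw [elasticNetProcess_eq_top hγ hl hj hc,
    elasticNetProcess_eq_ofReal hτ fun j _ => block_zero j] at h1
  exact ENNReal.ofReal_ne_top (top_le_iff.1 h1)

lemma IsElasticNetEstimate.le_of_block (hτ : τ ∈ Set.Ioo (0 : ℝ) 1) (hγ : 0 < γ) (hl : 0 < l₁)
    (hh : IsElasticNetEstimate τ γ l₁ l₂ x y n bt h)
    (hb : ∀ j, block bt j = 0 → block b j = 0) :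
    quantileProcess τ x y n h + penalty γ l₁ l₂ bt h ≤
      quantileProcess τ x y n b + penalty γ l₁ l₂ bt b := by
  have h1 := hh b
  rw [elasticNetProcess_eq_ofReal hτ (hh.block_eq_zero hτ hγ hl),
    elasticNetProcess_eq_ofReal hτ hb] at h1
  exact (ENNReal.ofReal_le_ofReal_iff
    (add_nonneg (quantileProcess_nonneg hτ y n b) (penalty_nonneg γ l₁ l₂ bt b))).1 h1

/-- Comparison of the penalties at `h` and at a point `b` that is supported on the groups of `A`,
on which the weights are bounded. -/
lemma penalty_add_le (A : Finset (Fin g)) {C B : ℝ} (hC : ∀ j ∈ A, ‖block bt j‖ ^ (-γ) ≤ C)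
    (hC0 : 0 ≤ C) (hb : ∀ j ∉ A, block b j = 0) (hB : ‖b‖ ≤ B) {j₀ : Fin g} :
    penalty γ l₁ l₂ bt b + (if j₀ ∈ A then 0 else l₁ * (‖block bt j₀‖ ^ (-γ) * ‖block h j₀‖)) ≤
      penalty γ l₁ l₂ bt h + g * (l₁ * C + 2 * l₂ * B) * ‖b - h‖ := by
  have hl1 : (0 : ℝ) ≤ l₁ := l₁.2
  have hl2 : (0 : ℝ) ≤ l₂ := l₂.2
  have hB0 : 0 ≤ B := (norm_nonneg b).trans hB
  have hj : ∀ j, l₁ * (‖block bt j‖ ^ (-γ) * ‖block b j‖) + l₂ * ‖block b j‖ ^ 2 +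
      (if j ∈ A then 0 else l₁ * (‖block bt j‖ ^ (-γ) * ‖block h j‖)) ≤
      l₁ * (‖block bt j‖ ^ (-γ) * ‖block h j‖) + l₂ * ‖block h j‖ ^ 2 +
        (l₁ * C + 2 * l₂ * B) * ‖b - h‖ := by
    intro j
    have hw : 0 ≤ ‖block bt j‖ ^ (-γ) := by positivity
    have hd : ‖block b j‖ - ‖block h j‖ ≤ ‖b - h‖ :=
      (norm_sub_norm_le _ _).trans (norm_block_le (b - h) j)
    have hbB : ‖block b j‖ ≤ B := (norm_block_le b j).trans hB
    by_cases hjA : j ∈ A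
    · rw [if_pos hjA]
      have e1 : ‖block bt j‖ ^ (-γ) * (‖block b j‖ - ‖block h j‖) ≤ C * ‖b - h‖ := by
        refine (mul_le_mul_of_nonneg_left hd hw).trans ?_
        exact mul_le_mul_of_nonneg_right (hC j hjA) (norm_nonneg _)
      have e2 : ‖block b j‖ ^ 2 - ‖block h j‖ ^ 2 ≤ 2 * B * ‖b - h‖ := by
        -- The tangent bound involves the norm of `b` only: `h` has not been localized yet.
        have f1 : ‖block b j‖ ^ 2 - ‖block h j‖ ^ 2 ≤
            2 * ‖block b j‖ * (‖block b j‖ - ‖block h j‖) := by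
          nlinarith [sq_nonneg (‖block b j‖ - ‖block h j‖)]
        have f2 : 2 * ‖block b j‖ * (‖block b j‖ - ‖block h j‖) ≤ 2 * ‖block b j‖ * ‖b - h‖ := by
          gcongr
        have f3 : 2 * ‖block b j‖ * ‖b - h‖ ≤ 2 * B * ‖b - h‖ := by gcongr
        linarith
      have e3 := mul_le_mul_of_nonneg_left e1 hl1
      have e4 := mul_le_mul_of_nonneg_left e2 hl2
      linarith
    · rw [if_neg hjA, hb j hjA]
      have e1 : 0 ≤ l₂ * ‖block h j‖ ^ 2 := by positivity
      have e2 : 0 ≤ (l₁ * C + 2 * l₂ * B) * ‖b - h‖ := by positivity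
      simp only [norm_zero]
      linarith
  have hsum := Finset.sum_le_sum fun j (_ : j ∈ Finset.univ) => hj j
  simp only [Finset.sum_add_distrib, ← Finset.mul_sum, Finset.sum_const, Finset.card_univ,
    Fintype.card_fin, nsmul_eq_mul] at hsum
  -- All the terms of insignificant groups are nonnegative, so keeping the one of `j₀` suffices.
  have hone := Finset.single_le_sum
    (f := fun j => if j ∈ A then 0 else l₁ * (‖block bt j‖ ^ (-γ) * ‖block h j‖))
    (fun j _ => by split_ifs <;> positivity) (Finset.mem_univ j₀)
  unfold penalty
  linarith

end Penalty

/-! ### Localization of the minimizers -/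

section Localization

variable {g p : ℕ} {Z Q : Param g p → ℝ} {W u : Param g p} {K K₁ c δ : ℝ}

/-- A function that is convex along the rays from the origin and close to a quadratic one on a
large ball grows faster than the norm outside this ball. -/
lemma norm_le_of_convex_ray (hZ : ∀ s ∈ Set.Icc (0 : ℝ) 1, ∀ v, Z (s • v) ≤ s * Z v)
    (hexp : ∀ v, ‖v‖ ≤ K → |Z v + inner ℝ W v - Q v| ≤ δ) (hδ : δ ≤ 1) (hW : ‖W‖ ≤ K₁)
    (hQ : ∀ v, c * ‖v‖ ^ 2 ≤ Q v) (hK : 0 < K) (hKc : (K₁ + 1) * K + 1 < c * K ^ 2)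
    (hu : Z u ≤ ‖u‖) : ‖u‖ ≤ K := by
  by_contra! hc
  have hu0 : 0 < ‖u‖ := hK.trans hc
  -- Pull u back to the sphere of radius K. Ray convexity gives Z v ≤ K, while the expansion gives Z
  -- v ≥ c K² - K₁ K - 1 > K.
  set v := (K / ‖u‖) • u with hv
  have hvn : ‖v‖ = K := by
    rw [hv, norm_smul, Real.norm_of_nonneg (by positivity)]; field_simp
  have h1 := hZ (K / ‖u‖) ⟨by positivity, (div_le_one hu0).2 hc.le⟩ u
  have h2 : K / ‖u‖ * Z u ≤ K := by
    calc K / ‖u‖ * Z u ≤ K / ‖u‖ * ‖u‖ := by gcongr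
      _ = K := by field_simp
  have h3 := (abs_le.1 (hexp v hvn.le)).1
  have h4 := hQ v
  have h5 : inner ℝ W v ≤ K₁ * K := by
    refine (real_inner_le_norm W v).trans ?_
    rw [hvn]; gcongr
  rw [hvn] at h4
  rw [← hv] at h1
  linarith

end Localization

/-- Bounds for the rescaled error `u = √n (h - β)` of an elastic-net estimate on the event on which
the rescaled quantile process is close to its quadratic expansion. -/
lemma IsElasticNetEstimate.rescaled_bounds {g p : ℕ} {τ γ : ℝ} {l₁ l₂ : ℝ≥0}
    {x : ℕ → Param g p} {y : ℕ → ℝ} {n : ℕ} {bt h β W : Param g p} {Q : Param g p → ℝ}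
    {K K₁ c δ m a r : ℝ} (hτ : τ ∈ Set.Ioo (0 : ℝ) 1) (hγ : 0 < γ) (hl : 0 < l₁)
    (hbt : IsQuantileEstimate τ x y n bt) (hh : IsElasticNetEstimate τ γ l₁ l₂ x y n bt h)
    (hexp : ∀ v, ‖v‖ ≤ K →
      |(quantileProcess τ x y n (β + r⁻¹ • v)) - quantileProcess τ x y n β + inner ℝ W v - Q v| ≤ δ)
    (hδ : δ ≤ 1) (hW : ‖W‖ ≤ K₁) (hQ : ∀ v, c * ‖v‖ ^ 2 ≤ Q v) (hc : 0 ≤ c) (hK : 0 < K)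
    (hKc : (K₁ + 1) * K + 1 < c * K ^ 2) (hr : 1 ≤ r) (hm : 0 < m)
    (hβ : ∀ j ∈ activeGroups β, m ≤ ‖block β j‖) (hrm : K / r ≤ m / 2)
    (ha : a = g * (l₁ * (m / 2) ^ (-γ) + 2 * l₂ * (‖β‖ + K)) / r) (ha1 : a ≤ 1) :
    ‖r • (h - β)‖ ≤ K ∧
    (∀ j ∉ activeGroups β, ‖block (r • (h - β)) j‖ ≤
      (K + K₁ * K + 1) * K ^ γ / (r ^ (γ - 1) * l₁)) ∧
    ∀ v, ‖v‖ ≤ K → (∀ j ∉ activeGroups β, block v j = 0) →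
      Q (r • (h - β)) - inner ℝ W (r • (h - β)) ≤ Q v - inner ℝ W v + 2 * δ + 2 * a * K := by
  have hr0 : 0 < r := by linarith
  have hl0 : (0 : ℝ) < l₁ := hl
  set A := activeGroups β with hA
  set Z : Param g p → ℝ := fun v =>
    quantileProcess τ x y n (β + r⁻¹ • v) - quantileProcess τ x y n β with hZdef
  have hZ : ∀ s ∈ Set.Icc (0 : ℝ) 1, ∀ v, Z (s • v) ≤ s * Z v := by
    intro s hs v
    have := quantileProcess_convex_ray (τ := τ) (x := x) y n β (r⁻¹ • v) hs
    rwa [smul_comm] at this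
  have hback : ∀ b : Param g p, β + r⁻¹ • (r • (b - β)) = b := by
    intro b
    rw [inv_smul_smul₀ hr0.ne']; abel
  have ha0 : 0 ≤ a := by rw [ha]; positivity
  have hut : ‖r • (bt - β)‖ ≤ K := by
    refine norm_le_of_convex_ray hZ hexp hδ hW hQ hK hKc ?_
    have : Z (r • (bt - β)) ≤ 0 := by
      simp only [hZdef]; rw [hback]; linarith [hbt β]
    exact this.trans (norm_nonneg _)
  have hbtβ : ‖bt - β‖ ≤ K / r := by
    rw [norm_smul, Real.norm_of_nonneg hr0.le] at hut
    rw [le_div_iff₀ hr0]; linarith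
  have hinact : ∀ j, j ∉ A → block β j = 0 := by
    intro j hj
    by_contra hne
    exact hj (by simp [hA, activeGroups, hne])
  have hblock : ∀ j, ‖block bt j - block β j‖ ≤ K / r := fun j =>
    (norm_block_le (bt - β) j).trans hbtβ
  have hact : ∀ j ∈ A, m / 2 ≤ ‖block bt j‖ := by
    intro j hj
    have h1 := hβ j hj
    have h2 := hblock j
    have h3 := norm_sub_norm_le (block β j) (block bt j)
    rw [norm_sub_rev] at h3
    linarith
  have hwt : ∀ j ∈ A, ‖block bt j‖ ^ (-γ) ≤ (m / 2) ^ (-γ) := fun j hj =>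
    Real.rpow_le_rpow_of_nonpos (by positivity) (hact j hj) (by linarith)
  set u := r • (h - β) with hu
  -- The basic inequality: `h` is compared with β + v/r. Support of v in the significant groups
  -- keeps the competitor's penalty finite and makes the penalty gap at most a‖v - u‖.
  have hmain : ∀ v, ‖v‖ ≤ K → (∀ j ∉ A, block v j = 0) → ∀ j₀,
      Z u + (if j₀ ∈ A then 0 else l₁ * (‖block bt j₀‖ ^ (-γ) * ‖block h j₀‖)) ≤
        Z v + a * ‖v - u‖ := by
    intro v hv hvA j₀
    have hbA : ∀ j ∉ A, block (β + r⁻¹ • v) j = 0 := by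
      intro j hj
      rw [block_add, block_smul, hvA j hj, hinact j hj]; simp
    have h1 := hh.le_of_block hτ hγ hl (b := β + r⁻¹ • v) fun j hj => by
      by_cases hjA : j ∈ A
      · have := hact j hjA
        rw [hj, norm_zero] at this
        linarith
      · exact hbA j hjA
    have hbB : ‖β + r⁻¹ • v‖ ≤ ‖β‖ + K := by
      refine (norm_add_le _ _).trans ?_
      rw [norm_smul, Real.norm_of_nonneg (by positivity)]
      have : r⁻¹ * ‖v‖ ≤ 1 * K :=
        mul_le_mul (inv_le_one_of_one_le₀ hr) hv (norm_nonneg _) one_pos.le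
      linarith
    have h2 := penalty_add_le (l₁ := l₁) (l₂ := l₂) (h := h) A hwt (by positivity) hbA hbB
      (j₀ := j₀)
    have h3 : β + r⁻¹ • v - h = r⁻¹ • (v - u) := by
      rw [hu, smul_sub, inv_smul_smul₀ hr0.ne']; abel
    have h4 : g * (l₁ * (m / 2) ^ (-γ) + 2 * l₂ * (‖β‖ + K)) * ‖β + r⁻¹ • v - h‖ =
        a * ‖v - u‖ := by
      rw [h3, norm_smul, Real.norm_of_nonneg (by positivity), ha]; ring
    rw [h4] at h2
    simp only [hZdef]
    rw [hu, hback]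
    rw [hu] at h2
    linarith
  have hZ0 : Z 0 = 0 := by simp [hZdef]
  have hzero : ∀ j₀, Z u + (if j₀ ∈ A then 0 else l₁ * (‖block bt j₀‖ ^ (-γ) * ‖block h j₀‖)) ≤
      a * ‖u‖ := by
    intro j₀
    have := hmain 0 (by simpa using hK.le) (fun j _ => block_zero j) j₀
    rwa [hZ0, zero_add, zero_sub, norm_neg] at this
  -- The competitor v = 0 and a ≤ 1 give Z u ≤ ‖u‖, as localization requires. With no groups there
  -- is no `j₀`, but then u = 0.
  have huK : ‖u‖ ≤ K := by
    rcases isEmpty_or_nonempty (Fin g) with hg | ⟨⟨j₀⟩⟩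
    · have : u = 0 := by ext q; exact hg.elim q.1
      rw [this, norm_zero]; exact hK.le
    · refine norm_le_of_convex_ray hZ hexp hδ hW hQ hK hKc ?_
      have h1 := hzero j₀
      have h2 : 0 ≤ if j₀ ∈ A then 0 else l₁ * (‖block bt j₀‖ ^ (-γ) * ‖block h j₀‖) := by
        split_ifs <;> positivity
      have h3 : a * ‖u‖ ≤ 1 * ‖u‖ := by gcongr
      linarith
  have hinner : inner ℝ W u ≤ K₁ * K := (real_inner_le_norm W u).trans
    (mul_le_mul hW huK (norm_nonneg _) ((norm_nonneg _).trans hW))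
  refine ⟨huK, fun j hj => ?_, fun v hv hvA => ?_⟩
  -- Inside the ball Z u ≥ -K₁ K - 1, so the penalty on one insignificant group is bounded.
  · have hD : l₁ * (‖block bt j‖ ^ (-γ) * ‖block h j‖) ≤ K + K₁ * K + 1 := by
      have h1 := hzero j
      rw [if_neg hj] at h1
      have h2 := (abs_le.1 (hexp u huK)).1
      have h3 := hQ u
      have h4 : 0 ≤ c * ‖u‖ ^ 2 := by positivity
      have h5 : a * ‖u‖ ≤ 1 * K := mul_le_mul ha1 huK (norm_nonneg _) one_pos.le
      linarith
    have huj : ‖block u j‖ = r * ‖block h j‖ := by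
      rw [hu, block_smul, block_sub, hinact j hj, sub_zero, norm_smul, Real.norm_of_nonneg hr0.le]
    rw [le_div_iff₀ (by positivity), huj]
    by_cases hbj : block bt j = 0
    · rw [hh.block_eq_zero hτ hγ hl j hbj]
      have : 0 ≤ K₁ := (norm_nonneg _).trans hW
      simp only [norm_zero, mul_zero, zero_mul]
      positivity
    · have hbjK : ‖block bt j‖ ≤ K / r := by
        have := hblock j
        rwa [hinact j hj, sub_zero] at this
      -- The quantile estimate of an insignificant block is O(1/r), so its weight is at least of
      -- order r^γ; this is the adaptivity of the penalty.
      have hw : (K / r) ^ (-γ) ≤ ‖block bt j‖ ^ (-γ) :=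
        Real.rpow_le_rpow_of_nonpos (norm_pos_iff.2 hbj) hbjK (by linarith)
      have hid : r * ‖block h j‖ * (r ^ (γ - 1) * l₁) =
          l₁ * ((K / r) ^ (-γ) * ‖block h j‖) * K ^ γ := by
        rw [Real.rpow_sub_one hr0.ne', Real.rpow_neg (by positivity), Real.div_rpow hK.le hr0.le]
        have := (Real.rpow_pos_of_pos hK γ).ne'
        have := (Real.rpow_pos_of_pos hr0 γ).ne'
        field_simp
      rw [hid]
      have : l₁ * ((K / r) ^ (-γ) * ‖block h j‖) ≤ K + K₁ * K + 1 := by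
        refine le_trans ?_ hD
        gcongr
      gcongr
  · have h1 : Z u ≤ Z v + a * ‖v - u‖ := by
      rcases isEmpty_or_nonempty (Fin g) with hg | ⟨⟨j₀⟩⟩
      · have : v = u := by ext q; exact hg.elim q.1
        rw [this]; simp
      · have h1 := hmain v hv hvA j₀
        have h2 : 0 ≤ if j₀ ∈ A then 0 else l₁ * (‖block bt j₀‖ ^ (-γ) * ‖block h j₀‖) := by
          split_ifs <;> positivity
        linarith
    have h2 := (abs_le.1 (hexp u huK)).1
    have h3 := (abs_le.1 (hexp v hv)).2
    have h4 : a * ‖v - u‖ ≤ a * (2 * K) := by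
      gcongr
      exact (norm_sub_le _ _).trans (by linarith)
    simp only [hZdef] at h1
    linarith

/-! ### The minimizer of the limit on the significant groups -/

section Oracle

variable {g p : ℕ} {U : Matrix (Fin g × Fin p) (Fin g × Fin p) ℝ} {A : Finset (Fin g)} {c : ℝ}

lemma sum_eq_sum_subIndex {F : Fin g × Fin p → ℝ} (hF : ∀ q, q.1 ∉ A → F q = 0) :
    ∑ q, F q = ∑ q : SubIndex p A, F q.1 := by
  rw [← Fintype.sum_subtype_add_sum_subtype (fun q : Fin g × Fin p => q.1 ∈ A) F,
    Finset.sum_eq_zero fun (q : {q : Fin g × Fin p // ¬ q.1 ∈ A}) _ => hF q.1 q.2, add_zero]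

lemma norm_subvector_le (b : Param g p) : ‖subvector A b‖ ≤ ‖b‖ := by
  refine (sq_le_sq₀ (norm_nonneg _) (norm_nonneg _)).1 ?_
  rw [EuclideanSpace.real_norm_sq_eq, EuclideanSpace.real_norm_sq_eq,
    ← Fintype.sum_subtype_add_sum_subtype (fun q : Fin g × Fin p => q.1 ∈ A) fun q => b q ^ 2]
  exact le_add_of_nonneg_right (Finset.sum_nonneg fun q _ => sq_nonneg _)

lemma apply_eq_zero_of_block {v : Param g p} (hv : ∀ j ∉ A, block v j = 0) (q : Fin g × Fin p)
    (hq : q.1 ∉ A) : v q = 0 := by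
  have := congrArg (fun b : EuclideanSpace ℝ (Fin p) => b q.2) (hv q.1 hq)
  simpa [block] using this

lemma mulVec_eq_submatrixOn {v : Param g p} (hv : ∀ j ∉ A, block v j = 0) (q : SubIndex p A) :
    U.mulVec v.ofLp q.1 = (submatrixOn A U).mulVec (subvector A v).ofLp q := by
  simp only [Matrix.mulVec, dotProduct]
  exact sum_eq_sum_subIndex fun r hr => by rw [apply_eq_zero_of_block hv r hr, mul_zero]

lemma dotProduct_mulVec_eq_submatrixOn {v : Param g p} (hv : ∀ j ∉ A, block v j = 0) :
    v.ofLp ⬝ᵥ U.mulVec v.ofLp =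
      (subvector A v).ofLp ⬝ᵥ (submatrixOn A U).mulVec (subvector A v).ofLp := by
  rw [dotProduct, sum_eq_sum_subIndex (A := A)
    fun q hq => by rw [apply_eq_zero_of_block hv q hq, zero_mul], dotProduct]
  refine Finset.sum_congr rfl fun q _ => ?_
  rw [mulVec_eq_submatrixOn hv]
  rfl

lemma submatrixOn_posDef (hU : U.PosDef) : (submatrixOn A U).PosDef :=
  hU.submatrix Subtype.val_injective

/-- The matrix `c⁻¹ U_A⁻¹`, extended by zero. -/
noncomputable def oracleMatrix (c : ℝ) (U : Matrix (Fin g × Fin p) (Fin g × Fin p) ℝ)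
    (A : Finset (Fin g)) : Matrix (Fin g × Fin p) (Fin g × Fin p) ℝ := fun q r =>
  if h : q.1 ∈ A ∧ r.1 ∈ A then c⁻¹ * (submatrixOn A U)⁻¹ ⟨q, h.1⟩ ⟨r, h.2⟩ else 0

/-- The minimizer of `c/2 vᵗ U v - wᵗ v` among the vectors supported on the groups of `A`. -/
noncomputable def oracle (c : ℝ) (U : Matrix (Fin g × Fin p) (Fin g × Fin p) ℝ)
    (A : Finset (Fin g)) : Param g p →L[ℝ] Param g p :=
  Matrix.toEuclideanCLM (𝕜 := ℝ) (oracleMatrix c U A)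

lemma oracle_apply (w : Param g p) (q : Fin g × Fin p) :
    oracle c U A w q = ∑ r, oracleMatrix c U A q r * w r := rfl

lemma block_oracle (w : Param g p) (j : Fin g) (hj : j ∉ A) : block (oracle c U A w) j = 0 := by
  ext k
  simp [block, oracle_apply, oracleMatrix, hj]

lemma subvector_oracle (w : Param g p) :
    (subvector A (oracle c U A w)).ofLp =
      c⁻¹ • (submatrixOn A U)⁻¹.mulVec (subvector A w).ofLp := by
  ext q
  have hq := q.2
  simp only [subvector, oracle_apply, Pi.smul_apply, smul_eq_mul, Matrix.mulVec, dotProduct,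
    Finset.mul_sum]
  rw [sum_eq_sum_subIndex (A := A) fun r hr => by simp [oracleMatrix, hr]]
  refine Finset.sum_congr rfl fun r _ => ?_
  have hr := r.2
  rw [oracleMatrix, dif_pos ⟨hq, hr⟩, mul_assoc]

/-- The normal equations of the oracle. -/
lemma mulVec_oracle (hU : U.PosDef) (hc : c ≠ 0) (w : Param g p) (q : Fin g × Fin p)
    (hq : q.1 ∈ A) : c * U.mulVec (oracle c U A w).ofLp q = w q := by
  have h1 := mulVec_eq_submatrixOn (U := U) (fun j hj => block_oracle (c := c) (U := U) w j hj)
    (⟨q, hq⟩ : SubIndex p A)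
  simp only at h1
  have hdet : IsUnit (submatrixOn A U).det :=
    (Matrix.isUnit_iff_isUnit_det _).1 (submatrixOn_posDef hU).isUnit
  rw [h1, subvector_oracle, Matrix.mulVec_smul, Matrix.mulVec_mulVec,
    Matrix.mul_nonsing_inv _ hdet, Matrix.one_mulVec]
  simp only [Pi.smul_apply, smul_eq_mul, mul_inv_cancel_left₀ hc]
  rfl

/-- The extension by zero of a vector indexed by the coordinates in the groups of `A`. -/
noncomputable def extendZero (t : EuclideanSpace ℝ (SubIndex p A)) : Param g p :=
  WithLp.toLp 2 fun q => if h : q.1 ∈ A then t ⟨q, h⟩ else 0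

lemma subvector_extendZero (t : EuclideanSpace ℝ (SubIndex p A)) :
    subvector A (extendZero t) = t := by
  ext q
  have hq := q.2
  simp [subvector, extendZero, hq]

lemma oracleMatrix_symm (hU : U.PosDef) (q r : Fin g × Fin p) :
    oracleMatrix c U A q r = oracleMatrix c U A r q := by
  have hs := (submatrixOn_posDef (A := A) hU).inv.isHermitian
  unfold oracleMatrix
  by_cases h : q.1 ∈ A ∧ r.1 ∈ A
  · rw [dif_pos h, dif_pos h.symm]
    have := hs.apply ⟨q, h.1⟩ ⟨r, h.2⟩
    rw [← this]; simp
  · rw [dif_neg h, dif_neg fun h' => h h'.symm]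

/-- The oracle matrix is symmetric, so a projection of the oracle is a projection of the score sum,
to which the scalar limit theorem applies. -/
lemma inner_subvector_oracle (hU : U.PosDef) (w : Param g p)
    (t : EuclideanSpace ℝ (SubIndex p A)) :
    inner ℝ (subvector A (oracle c U A w)) t = inner ℝ w (oracle c U A (extendZero t)) := by
  have h1 : inner ℝ (subvector A (oracle c U A w)) t =
      ∑ q, extendZero t q * oracle c U A w q := by
    rw [PiLp.inner_apply, sum_eq_sum_subIndex (A := A) fun q hq => by simp [extendZero, hq]]
    refine Finset.sum_congr rfl fun q _ => ?_
    have hq := q.2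
    simp [subvector, extendZero, hq]
  rw [h1, PiLp.inner_apply]
  simp only [oracle_apply, Finset.mul_sum, RCLike.inner_apply, conj_trivial, Finset.sum_mul]
  rw [Finset.sum_comm]
  refine Finset.sum_congr rfl fun r _ => Finset.sum_congr rfl fun q _ => ?_
  rw [oracleMatrix_symm hU q r]
  ring

/-- The sandwich U_A⁻¹ U_A U_A⁻¹ collapses to U_A⁻¹, which produces the limit covariance. -/
lemma oracle_extendZero_form (hU : U.PosDef) (t : EuclideanSpace ℝ (SubIndex p A)) :
    (oracle c U A (extendZero t)).ofLp ⬝ᵥ U.mulVec (oracle c U A (extendZero t)).ofLp =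
      c ^ (-2 : ℤ) * (t.ofLp ⬝ᵥ (submatrixOn A U)⁻¹.mulVec t.ofLp) := by
  have hdet : IsUnit (submatrixOn A U).det :=
    (Matrix.isUnit_iff_isUnit_det _).1 (submatrixOn_posDef hU).isUnit
  rw [dotProduct_mulVec_eq_submatrixOn (fun j hj => block_oracle (extendZero t) j hj),
    subvector_oracle, subvector_extendZero, Matrix.mulVec_smul, Matrix.mulVec_mulVec,
    Matrix.mul_nonsing_inv _ hdet, Matrix.one_mulVec, smul_dotProduct, dotProduct_smul,
    dotProduct_comm, smul_eq_mul, smul_eq_mul, zpow_neg, ← mul_assoc]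
  congr 1
  rw [zpow_ofNat, sq, mul_inv]

/-- Compactness of the unit sphere, then homogeneity of degree two. -/
lemma exists_limitForm_lower_bound (hU : U.PosDef) (hc : 0 < c) :
    ∃ k > 0, ∀ v : Param g p, k * ‖v‖ ^ 2 ≤ limitForm c U v := by
  have hpos : ∀ v ∈ Metric.sphere (0 : Param g p) 1, 0 < limitForm c U v := by
    intro v hv
    have hv0 : v.ofLp ≠ 0 := by
      intro h0
      have : v = 0 := by ext q; exact congrFun h0 q
      simp [this] at hv
    have := hU.dotProduct_mulVec_pos hv0
    simp only [star_trivial] at this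
    unfold limitForm
    positivity
  obtain ⟨k, hk, hkv⟩ := (isCompact_sphere (0 : Param g p) 1).exists_forall_le'
    (continuous_limitForm c U).continuousOn hpos
  refine ⟨k, hk, fun v => ?_⟩
  by_cases hv : v = 0
  · simp [hv, limitForm]
  · have hn : 0 < ‖v‖ := norm_pos_iff.2 hv
    have h1 := hkv (‖v‖⁻¹ • v) (by simp [norm_smul, hn.ne'])
    have h2 : limitForm c U (‖v‖⁻¹ • v) = (‖v‖ ^ 2)⁻¹ * limitForm c U v := by
      unfold limitForm
      simp only [WithLp.ofLp_smul, Matrix.mulVec_smul, smul_dotProduct, dotProduct_smul,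
        smul_eq_mul]
      ring
    rw [h2, le_inv_mul_iff₀ (by positivity)] at h1
    linarith

lemma limitForm_sub (hU : U.PosDef) (u v : Param g p) :
    limitForm c U (u - v) =
      limitForm c U u - limitForm c U v - c * (U.mulVec v.ofLp ⬝ᵥ (u - v).ofLp) := by
  have hsymm : v.ofLp ⬝ᵥ U.mulVec u.ofLp = U.mulVec v.ofLp ⬝ᵥ u.ofLp := by
    have ht : U.transpose = U := by simpa using hU.isHermitian.eq
    rw [Matrix.dotProduct_mulVec, ← Matrix.mulVec_transpose, ht]
  have hcomm : u.ofLp ⬝ᵥ U.mulVec v.ofLp = U.mulVec v.ofLp ⬝ᵥ u.ofLp := dotProduct_comm _ _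
  have hcomm' : v.ofLp ⬝ᵥ U.mulVec v.ofLp = U.mulVec v.ofLp ⬝ᵥ v.ofLp := dotProduct_comm _ _
  unfold limitForm
  simp only [WithLp.ofLp_sub, Matrix.mulVec_sub, sub_dotProduct, dotProduct_sub, hsymm, hcomm,
    hcomm']
  ring

/-- The gap of the limit criterion bounds the distance to the oracle, up to the insignificant
groups. -/
lemma limitForm_sub_oracle_le (hU : U.PosDef) (hc : 0 < c) :
    ∃ L ≥ 0, ∀ (w u : Param g p) (κ : ℝ), (∀ j ∉ A, ‖block u j‖ ≤ κ) → 0 ≤ κ →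
      limitForm c U (u - oracle c U A w) ≤
        (limitForm c U u - inner ℝ w u) -
          (limitForm c U (oracle c U A w) - inner ℝ w (oracle c U A w)) + L * ‖w‖ * κ := by
  -- R w is minus the gradient of the criterion at the oracle. It vanishes on the coordinates in `A`
  -- by the normal equations; elsewhere the oracle is 0 and u is at most κ.
  set R : Param g p →L[ℝ] Param g p :=
    ContinuousLinearMap.id ℝ _ - c • (Matrix.toEuclideanCLM (𝕜 := ℝ) U).comp (oracle c U A) with hR
  refine ⟨Fintype.card (Fin g × Fin p) * ‖R‖, by positivity, fun w u κ hu hκ => ?_⟩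
  have hRq : ∀ q, R w q = w q - c * U.mulVec (oracle c U A w).ofLp q := fun q => rfl
  have hinner : inner ℝ w (u - oracle c U A w) -
      c * (U.mulVec (oracle c U A w).ofLp ⬝ᵥ (u - oracle c U A w).ofLp) =
      ∑ q, R w q * (u - oracle c U A w) q := by
    rw [PiLp.inner_apply, dotProduct, Finset.mul_sum, ← Finset.sum_sub_distrib]
    refine Finset.sum_congr rfl fun q _ => ?_
    rw [hRq]
    simp only [RCLike.inner_apply, conj_trivial]
    ring
  have hbound : ∑ q, R w q * (u - oracle c U A w) q ≤
      Fintype.card (Fin g × Fin p) * ‖R‖ * ‖w‖ * κ := by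
    calc ∑ q, R w q * (u - oracle c U A w) q ≤ ∑ _q : Fin g × Fin p, ‖R‖ * ‖w‖ * κ := by
          refine Finset.sum_le_sum fun q _ => ?_
          by_cases hq : q.1 ∈ A
          · rw [hRq, mulVec_oracle hU hc.ne' w q hq, sub_self, zero_mul]
            positivity
          · have h0 : oracle c U A w q = 0 :=
              apply_eq_zero_of_block (fun j hj => block_oracle w j hj) q hq
            have h1 : (u - oracle c U A w) q = u q := by simp [h0]
            rw [h1]
            refine (le_abs_self _).trans ?_
            rw [abs_mul]
            refine mul_le_mul ?_ ((abs_apply_le_norm_block u q).trans (hu q.1 hq)) (abs_nonneg _)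
              (by positivity)
            exact ((abs_apply_le_norm_block _ q).trans (norm_block_le _ _)).trans (R.le_opNorm w)
      _ = Fintype.card (Fin g × Fin p) * ‖R‖ * ‖w‖ * κ := by simp; ring
  rw [limitForm_sub hU]
  rw [inner_sub_right] at hinner
  linarith

end Oracle

/-! ### Limit law of the oracle -/

section LimitLaw

variable {g p : ℕ} {Ω : Type*} [MeasurableSpace Ω] {P : Measure Ω} [IsProbabilityMeasure P]
  {ε : ℕ → Ω → ℝ} {f : ℝ → ℝ} {τ : ℝ}
  {x : ℕ → Param g p} {U : Matrix (Fin g × Fin p) (Fin g × Fin p) ℝ}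

omit [IsProbabilityMeasure P] in
lemma ErrorAssumption.measurable_scoreSum (h : ErrorAssumption P ε f τ) (n : ℕ) :
    Measurable fun ω => scoreSum τ x (fun i => ε i ω) n :=
  Finset.measurable_fun_sum _ fun i _ =>
    (((measurable_checkScore τ).comp (h.measurable i)).div_const _).smul_const _

lemma measurable_subvector (A : Finset (Fin g)) :
    Measurable (subvector A : Param g p → EuclideanSpace ℝ (SubIndex p A)) := by
  unfold subvector
  fun_prop

omit [IsProbabilityMeasure P] in
lemma charFun_map_eq_charFun_inner {E : Type*} [NormedAddCommGroup E] [InnerProductSpace ℝ E]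
    [MeasurableSpace E] [BorelSpace E] [SecondCountableTopology E] {X : Ω → E}
    (hX : AEMeasurable X P)
    (t : E) : charFun (P.map X) t = charFun (P.map fun ω => inner ℝ (X ω) t) 1 := by
  rw [charFun_apply, charFun_apply, integral_map hX (by fun_prop),
    integral_map (by fun_prop) (by fun_prop)]
  simp

/-- Lévy's continuity theorem: the projection on t is a weighted score sum whose weights form the
small array of the direction `oracle (f 0) U A (extendZero t)`. -/
lemma DesignAssumption.tendstoInDistribution_oracle (hx : DesignAssumption x U)
    (h : ErrorAssumption P ε f τ) (hτ : τ ∈ Set.Ioo (0 : ℝ) 1) (A : Finset (Fin g)) :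
    TendstoInDistribution
      (fun n ω => subvector A (oracle (f 0) U A (scoreSum τ x (fun i => ε i ω) n)))
      atTop id (fun _ => P)
      (multivariateGaussian 0 ((τ * (1 - τ) * (f 0) ^ (-2 : ℤ)) • (submatrixOn A U)⁻¹)) := by
  have hmeas : ∀ n, Measurable fun ω =>
      subvector A (oracle (f 0) U A (scoreSum τ x (fun i => ε i ω) n)) := fun n =>
    (measurable_subvector A).comp ((oracle (f 0) U A).measurable.comp (h.measurable_scoreSum n))
  have hpsd : ((τ * (1 - τ) * (f 0) ^ (-2 : ℤ)) • (submatrixOn A U)⁻¹).PosSemidef := by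
    refine (submatrixOn_posDef hx.posDef).inv.posSemidef.smul ?_
    have := h.pos_zero
    have : 0 ≤ τ * (1 - τ) := mul_nonneg hτ.1.le (by linarith [hτ.2])
    positivity
  refine ⟨fun n => (hmeas n).aemeasurable, aemeasurable_id, ?_⟩
  refine ProbabilityMeasure.tendsto_iff_tendsto_charFun.2 fun t => ?_
  simp only [ProbabilityMeasure.coe_mk, Measure.map_id]
  rw [charFun_multivariateGaussian hpsd]
  have hlim := (hx.isSmallArray_inner (oracle (f 0) U A
    (extendZero t))).tendsto_charFun_sum_checkScore h hτ
  rw [oracle_extendZero_form hx.posDef] at hlim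
  have hexp : Complex.exp (-(τ * (1 - τ) *
      ((f 0) ^ (-2 : ℤ) * (t.ofLp ⬝ᵥ (submatrixOn A U)⁻¹.mulVec t.ofLp)) / 2 : ℝ)) =
      Complex.exp (((inner ℝ t (0 : EuclideanSpace ℝ (SubIndex p A)) : ℝ) : ℂ) * Complex.I -
        ((t.ofLp ⬝ᵥ ((τ * (1 - τ) * (f 0) ^ (-2 : ℤ)) • (submatrixOn A U)⁻¹).mulVec t.ofLp : ℝ) : ℂ)
          / 2) := by
    rw [inner_zero_right, Matrix.smul_mulVec, dotProduct_smul, smul_eq_mul]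
    push_cast
    congr 1
    ring
  rw [← hexp]
  refine hlim.congr fun n => ?_
  rw [charFun_map_eq_charFun_inner (hmeas n).aemeasurable]
  congr 2
  ext ω
  rw [inner_subvector_oracle hx.posDef, inner_scoreSum]

end LimitLaw

/-! ### Asymptotic normality of the elastic-net estimate -/

section Tuning

variable {γ : ℝ} {l₁ l₂ : ℕ → ℝ≥0}

lemma natCast_rpow_neg_half (n : ℕ) : (n : ℝ) ^ (-(1 / 2) : ℝ) = (√(n : ℝ))⁻¹ := by
  rw [Real.rpow_neg (Nat.cast_nonneg n), ← Real.sqrt_eq_rpow]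

lemma TuningCondition.tendsto_active (hC : TuningCondition γ l₁ l₂) (c C B : ℝ) :
    Tendsto (fun n : ℕ => c * ((l₁ n : ℝ) * C + 2 * (l₂ n : ℝ) * B) / √(n : ℝ)) atTop (𝓝 0) := by
  have h := ((hC.l₁_small.mul_const C).add ((hC.l₂_small.mul_const (2 * B)))).const_mul c
  simp only [zero_mul, add_zero, mul_zero] at h
  refine h.congr fun n => ?_
  rw [natCast_rpow_neg_half]
  ring

lemma TuningCondition.tendsto_inactive (hC : TuningCondition γ l₁ l₂) (D : ℝ) :
    Tendsto (fun n : ℕ => D / (√(n : ℝ) ^ (γ - 1) * (l₁ n : ℝ))) atTop (𝓝 0) := by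
  have h := hC.l₁_large.inv_tendsto_atTop.const_mul D
  rw [mul_zero] at h
  refine h.congr fun n => ?_
  rw [Pi.inv_apply, Real.sqrt_eq_rpow, ← Real.rpow_mul (Nat.cast_nonneg n),
    show 1 / 2 * (γ - 1) = (γ - 1) / 2 by ring]
  exact (div_eq_mul_inv _ _).symm

end Tuning

lemma exists_active_lower_bound {g p : ℕ} (β : Param g p) :
    ∃ m > 0, ∀ j ∈ activeGroups β, m ≤ ‖block β j‖ := by
  rcases (activeGroups β).eq_empty_or_nonempty with h | h
  · exact ⟨1, one_pos, by simp [h]⟩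
  · obtain ⟨j, hj, hmin⟩ := Finset.exists_min_image _ (fun j => ‖block β j‖) h
    refine ⟨‖block β j‖, norm_pos_iff.2 ?_, hmin⟩
    simpa [activeGroups] using hj

section Main

variable {g p : ℕ} {Ω : Type*} [MeasurableSpace Ω] {P : Measure Ω} [IsProbabilityMeasure P]
  {ε Y : ℕ → Ω → ℝ} {f : ℝ → ℝ} {τ γ : ℝ} {l₁ l₂ : ℕ → ℝ≥0}
  {x : ℕ → Param g p} {β₀ : Param g p} {U : Matrix (Fin g × Fin p) (Fin g × Fin p) ℝ}
  {βt βh : ℕ → Ω → Param g p}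

/-- The rescaled error is close to the oracle with probability close to one. -/
lemma DesignAssumption.exists_likely_close_oracle (hx : DesignAssumption x U)
    (h : ErrorAssumption P ε f τ) (hτ : τ ∈ Set.Ioo (0 : ℝ) 1) (hγ : 0 < γ)
    (hC : TuningCondition γ l₁ l₂) (hY : ∀ i ω, Y i ω = inner ℝ (x i) β₀ + ε i ω)
    (hβt : ∀ n, ∀ᵐ ω ∂P, IsQuantileEstimate τ x (fun i => Y i ω) n (βt n ω))
    (hβh : ∀ n, ∀ᵐ ω ∂P, IsElasticNetEstimate τ γ (l₁ n) (l₂ n) x (fun i => Y i ω) n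
      (βt n ω) (βh n ω)) {e K₁ : ℝ} (he : 0 < e) (hK₁ : 0 < K₁) :
    EventuallyLikely P (fun n ω => ‖scoreSum τ x (fun i => ε i ω) n‖ ≤ K₁ →
      ‖√(n : ℝ) • (βh n ω - β₀) -
        oracle (f 0) U (activeGroups β₀) (scoreSum τ x (fun i => ε i ω) n)‖ < e) := by
  have hf := h.pos_zero
  set A := activeGroups β₀ with hA
  set T := oracle (f 0) U A with hT
  obtain ⟨c, hc, hQ⟩ := exists_limitForm_lower_bound hx.posDef hf
  obtain ⟨L, hL, hgap⟩ := limitForm_sub_oracle_le (A := A) hx.posDef hf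
  obtain ⟨m, hm, hβ⟩ := exists_active_lower_bound β₀
  -- The first term yields c K ≥ K₁ + 3, hence with K ≥ 1 the growth condition of the localization;
  -- the second keeps the oracle inside the ball.
  set K : ℝ := (K₁ + 3) / c + ‖T‖ * K₁ + 1 with hKdef
  have hK1 : 1 ≤ K := by
    rw [hKdef]
    have : 0 ≤ (K₁ + 3) / c + ‖T‖ * K₁ := by positivity
    linarith
  have hK : 0 < K := by linarith
  have hTK : ‖T‖ * K₁ ≤ K := by
    rw [hKdef]
    have : 0 ≤ (K₁ + 3) / c := by positivity
    linarith
  have hKc : (K₁ + 1) * K + 1 < c * K ^ 2 := by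
    have h1 : K₁ + 3 ≤ c * K := by
      calc K₁ + 3 = c * ((K₁ + 3) / c) := by field_simp
        _ ≤ c * K := by
          have : 0 ≤ ‖T‖ * K₁ + 1 := by positivity
          gcongr
          rw [hKdef]; linarith
    nlinarith
  -- The 1 is for localization. The other bound makes 2δ ≤ c e²/4, so that with the penalty and
  -- insignificant-group errors, below c e²/4, the total stays below c e².
  set δ : ℝ := min 1 (c * e ^ 2 / 8) with hδ
  have hδ0 : 0 < δ := by positivity
  have hunif := hx.eventuallyLikely_remainderSum h hK hδ0
  set a : ℕ → ℝ := fun n =>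
    g * ((l₁ n : ℝ) * (m / 2) ^ (-γ) + 2 * (l₂ n : ℝ) * (‖β₀‖ + K)) / √(n : ℝ) with ha
  set κ : ℕ → ℝ := fun n =>
    (K + K₁ * K + 1) * K ^ γ / (√(n : ℝ) ^ (γ - 1) * (l₁ n : ℝ)) with hκ
  have ha_lim : Tendsto a atTop (𝓝 0) := hC.tendsto_active _ _ _
  have hκ_lim : Tendsto κ atTop (𝓝 0) := hC.tendsto_inactive _
  have hsmall : Tendsto (fun n => 2 * a n * K + L * K₁ * κ n) atTop (𝓝 0) := by
    have := ((ha_lim.const_mul 2).mul_const K).add (hκ_lim.const_mul (L * K₁))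
    simpa using this
  have hsqrt : Tendsto (fun n : ℕ => √(n : ℝ)) atTop atTop :=
    Real.tendsto_sqrt_atTop.comp tendsto_natCast_atTop_atTop
  refine (hunif.and ((eventuallyLikely_of_ae hβt).and (eventuallyLikely_of_ae hβh))).mono ?_
  filter_upwards [hC.l₁_atTop.eventually_gt_atTop 0, hsqrt.eventually_ge_atTop 1,
    hsqrt.eventually_ge_atTop (K / (m / 2)), ha_lim.eventually_lt_const one_pos,
    hsmall.eventually_lt_const (show 0 < c * e ^ 2 / 4 by positivity)]
    with n hl hn1 hn2 ha1 hn3 ω ⟨hexp, ht, hh⟩ hW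
  have hrm : K / √(n : ℝ) ≤ m / 2 := by
    rw [div_le_iff₀ (by positivity)] at hn2
    rw [div_le_iff₀ (by linarith)]
    linarith
  have hexp' : ∀ v, ‖v‖ ≤ K → |(quantileProcess τ x (fun i => Y i ω) n
      (β₀ + (√(n : ℝ))⁻¹ • v)) -
      quantileProcess τ x (fun i => Y i ω) n β₀ +
      inner ℝ (scoreSum τ x (fun i => ε i ω) n) v - limitForm (f 0) U v| ≤ δ := by
    intro v hv
    rw [quantileProcess_sub (e := fun i => ε i ω) fun i => hY i ω]
    convert hexp v hv using 2
    ring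
  obtain ⟨_, hinact, hcomp⟩ := hh.rescaled_bounds hτ hγ hl ht hexp' (min_le_left _ _) hW hQ hc.le
    hK hKc hn1 hm hβ hrm rfl ha1.le
  set W := scoreSum τ x (fun i => ε i ω) n with hWdef
  have hTW : ‖T W‖ ≤ K := (T.le_opNorm W).trans ((by gcongr : ‖T‖ * ‖W‖ ≤ ‖T‖ * K₁).trans hTK)
  have h1 := hcomp (T W) hTW fun j hj => block_oracle W j hj
  have hκ0 : 0 ≤ κ n := by simp only [hκ]; positivity
  have h2 := hgap W (√(n : ℝ) • (βh n ω - β₀)) (κ n) hinact hκ0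
  have h3 := hQ (√(n : ℝ) • (βh n ω - β₀) - T W)
  have h4 : L * ‖W‖ * κ n ≤ L * K₁ * κ n := by gcongr
  have h5 : δ ≤ c * e ^ 2 / 8 := min_le_right _ _
  have h6 : c * ‖√(n : ℝ) • (βh n ω - β₀) - T W‖ ^ 2 < c * e ^ 2 := by
    have : 0 < c * e ^ 2 := by positivity
    change _ ≤ _ + 2 * a n * K at h1
    linarith
  exact lt_of_pow_lt_pow_left₀ 2 he.le (lt_of_mul_lt_mul_left h6 hc.le)

end Main

end GroupQuantile

theorem mainTheorem3 {g p : ℕ} {Ω : Type*} [MeasurableSpace Ω] (P : Measure Ω)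
    [IsProbabilityMeasure P]
    (τ : ℝ) (hτ : τ ∈ Set.Ioo (0 : ℝ) 1) (γ : ℝ) (hγ : 0 < γ)
    -- deterministic design, true parameter, errors and responses
    (x : ℕ → GroupQuantile.Param g p) (β₀ : GroupQuantile.Param g p)
    (ε Y : ℕ → Ω → ℝ) (hY : ∀ i ω, Y i ω = inner ℝ (x i) β₀ + ε i ω)
    (f : ℝ → ℝ) (hA1 : GroupQuantile.ErrorAssumption P ε f τ)
    (U : Matrix (Fin g × Fin p) (Fin g × Fin p) ℝ)
    (hA6 : GroupQuantile.DesignAssumption x U)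
    (l₁ l₂ : ℕ → ℝ≥0) (hC1 : GroupQuantile.TuningCondition γ l₁ l₂)
    -- the quantile estimator and the adaptive elastic-net estimator, for every sample size
    (βt βh : ℕ → Ω → GroupQuantile.Param g p)
    (hβt_meas : ∀ n, AEMeasurable (βt n) P) (hβh_meas : ∀ n, AEMeasurable (βh n) P)
    (hβt : ∀ n, ∀ᵐ ω ∂P, GroupQuantile.IsQuantileEstimate τ x (fun i => Y i ω) n (βt n ω))
    (hβh : ∀ n, ∀ᵐ ω ∂P, GroupQuantile.IsElasticNetEstimate τ γ (l₁ n) (l₂ n) x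
      (fun i => Y i ω) n (βt n ω) (βh n ω)) :
    TendstoInDistribution
      (fun (n : ℕ) ω => √(n : ℝ) •
        GroupQuantile.subvector (GroupQuantile.activeGroups β₀) (βh n ω - β₀))
      atTop id (fun _ => P)
      (multivariateGaussian 0
        ((τ * (1 - τ) * (f 0) ^ (-2 : ℤ)) •
          (GroupQuantile.submatrixOn (GroupQuantile.activeGroups β₀) U)⁻¹)) := by
  -- Slutsky: it remains to show that the rescaled error and the oracle differ by a term tending to
  -- 0 in probability.
  refine tendstoInDistribution_of_tendstoInMeasure_sub _ _
    (hA6.tendstoInDistribution_oracle hA1 hτ (GroupQuantile.activeGroups β₀)) ?_ fun n =>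
      ((GroupQuantile.measurable_subvector (GroupQuantile.activeGroups β₀)).comp_aemeasurable
        ((hβh_meas n).sub_const β₀)).const_smul (√(n : ℝ))
  rw [tendstoInMeasure_iff_norm]
  intro e he
  rw [ENNReal.tendsto_nhds_zero]
  intro η hη
  obtain ⟨η', hη', hηη'⟩ : ∃ η' : ℝ, 0 < η' ∧ ENNReal.ofReal η' + ENNReal.ofReal η' ≤ η := by
    obtain ⟨r, hr0, hr⟩ := ENNReal.lt_iff_exists_nnreal_btwn.1 hη
    refine ⟨r / 2, half_pos (by exact_mod_cast hr0), ?_⟩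
    rw [← ENNReal.ofReal_add (by positivity) (by positivity), add_halves, ENNReal.ofReal_coe_nnreal]
    exact hr.le
  -- K₁ is fixed by tightness before closeness is invoked: one η' pays for a large score sum, the
  -- other for failure of closeness when the score sum is at most K₁.
  obtain ⟨K₁, hK₁, htight⟩ := hA6.scoreSum_tight hA1 hτ hη'
  have hclose := hA6.exists_likely_close_oracle hA1 hτ hγ hC1 hY hβt hβh he hK₁
  filter_upwards [htight, (ENNReal.tendsto_nhds_zero.1 hclose) (ENNReal.ofReal η') (by simpa)]
    with n h1 h2
  refine le_trans ((measure_mono fun ω hω => ?_).trans (measure_union_le _ _))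
    ((add_le_add h1 h2).trans hηη')
  by_contra hc
  simp only [Set.mem_union, Set.mem_ofPred_eq, not_or, not_not] at hc
  refine absurd (hc.2 hc.1) (not_lt.2 (le_trans hω ?_))
  refine le_trans (le_of_eq ?_)
    (GroupQuantile.norm_subvector_le (A := GroupQuantile.activeGroups β₀) _)
  congr 1
  ext q
  simp [GroupQuantile.subvector]
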